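/- **Setting.** For a non-negative Borel measure $\lambda$ on $\mathbb R$ and $n\in\mathbb R$, say $\lambda\in\mathcal M^{(n)}$ if $\lambda$ is locally finite and $\int(1+s^2)^{-n/2}\,d\lambda(s)<\infty$. For $\lambda\in\mathcal M^{(1)}$ and $\Im z>0$ let $$Q[\lambda](z)=\int\frac{i\,d\lambda(s)}{\pi(z-s)},\qquad H[\lambda](t)=\lim_{\varepsilon\to0^+}\Im Q[\lambda](t+i\varepsilon)$$ wherever the limit exists. For $\lambda\in\mathcal M^{(1)}$, $c_0\in\mathbb R$, $c_1\ge0$, write $\mathcal B_{\mathbb R}[\lambda,c_0,c_1]=(\mu,\zeta_0,\zeta_1)$ if $(\mu,\zeta_0,\zeta_1)$ is the unique triple with $\mu\in\mathcal M^{(1)}$ (possibly $\mu=0$), $\zeta_0\in\mathbb R$, $\zeta_1\ge0$ such that, for all $\Im z>0$, $$\big(Q[\lambda](z)-i\pi^{-1}(c_0+c_1z)\big)\big(Q[\mu](z)-i\pi^{-1}(\zeta_0+\zeta_1z)\big)=1;$$ $\mathcal B_{\mathbb R}[\lambda,c_0,c_1]$ is well-defined if exactly one such triple exists. Let $$N_0(\lambda)=\bigcap_{\varepsilon>0}\operatorname{clos}\Big\{s\in\mathbb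 R:\limsup_{\delta\to0^+}\frac{\lambda([s-\delta,s+\delta])}{2\delta}<\varepsilon\Big\}.$$ Let $L^*(\mathbb R)$ be the set of non-negative $f\in L^1(\mathbb R)$ such that $(1+s^2)^{1/2}f(s)$ and $s^2f(s)$ are in $L^1(\mathbb R)$ and the Fourier transform of $s\mapsto s^2f(s)$ is in $L^1(\mathbb R)$. **Theorem (Closed form of $\mathcal B_{\mathbb R}$).** Let $\lambda=\lambda_1+\lambda_2\neq0$, where $\lambda_1\in L^*(\mathbb R)$ (identified with the measure $\lambda_1(s)\,ds$) and $\lambda_2$ is a finite, compactly supported, non-negative Borel measure. Let $c_0\in\mathbb R$ and $c_1\ge0$, and suppose that $$Z'=\big(N_0(\lambda)\cap\operatorname{supp}\lambda\big)\cup\{s\notin\operatorname{supp}\lambda: H[\lambda](s)-\pi^{-1}(c_1s+c_0)=0\}$$ contains none of its limit points. Let $\lambda_c$ be the Lebesgue density of the absolutely continuous part of $\lambda$. Then $\lambda\in\mathcal M^{(-1)}$, the limit $H[\lambda]$ exists almost everywhere, and $\mathcal B_{\mathbb R}[\lambda,c_0,c_1]=(\mu,\zeta_0,\zeta_1)$ is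 well-defined, with $$\mu=\mu_c(s)\,ds+\sum_{\alpha\in Z}\beta_\alpha\delta_\alpha,\qquad \mu_c(s)=\frac{\lambda_c(s)}{\lambda_c(s)^2+\big(H[\lambda](s)-\pi^{-1}(c_1s+c_0)\big)^2}\in L^1(\mathbb R),$$ where the set $$Z=N_0(\lambda)\cap\{s\in\mathbb R: H[\lambda](s)\text{ exists and }H[\lambda](s)-\pi^{-1}(c_1s+c_0)=0\}$$ contains none of its limit points, and $$\beta_\alpha=\pi^2\Big(c_1+\int\frac{d\lambda(\tau)}{(\tau-\alpha)^2}\Big)^{-1}\qquad(\alpha\in Z),$$ with the integrand equal to $+\infty$ at $\tau=\alpha$ and $\beta_\alpha=0$ if the integral diverges. Moreover: 1. if $c_1\ne0$, then $\zeta_0=\zeta_1=0$; 2. if $c_1=0$ and $c_0\neq0$, then $\zeta_1=0$ and $\zeta_0=-\pi^2/c_0$; 3. if $c_0=c_1=0$, then $\zeta_0=-\dfrac{\pi^2}{\|\lambda\|^2}\displaystyle\int\tau\,d\lambda(\tau)$ and $\zeta_1=\dfrac{\pi^2}{\|\lambda\|}$, where $\|\lambda\|=\lambda(\mathbb R)$.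 -/

import Mathlib

open MeasureTheory Filter Topology

noncomputable section

/-- Membership of a non-negative Borel measure on the line in the weighted class of order `n`:
locally finite, with `∫ (1 + s²)^(-n/2) dμ(s) < ∞`. The zero measure is not excluded here. -/
def MemWeighted (n : ℝ) (μ : Measure ℝ) : Prop :=
  IsLocallyFiniteMeasure μ ∧ Integrable (fun s : ℝ => (1 + s ^ 2) ^ (-n / 2)) μ

/-- The class `L*(ℝ)`: non-negative integrable `f` with `(1 + s²)^{1/2} f(s)` integrable and with
`s ↦ s² f(s)` an integrable function whose Fourier transform is integrable. Mathlib's Fourier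
transform (with kernel `exp (-2πiξs)`) differs from the one with kernel `exp (-iξs)` by a
rescaling of the frequency variable only. The integrability of `s² f(s)` is listed because
`FourierTransform.fourier` of a non-integrable function is zero. -/
structure MemLStar (f : ℝ → ℝ) : Prop where
  nonneg : ∀ᵐ s : ℝ, 0 ≤ f s
  integrable : Integrable f
  integrable_weight : Integrable (fun s : ℝ => (1 + s ^ 2) ^ (1 / 2 : ℝ) * f s)
  integrable_sq : Integrable (fun s : ℝ => s ^ 2 * f s)
  integrable_fourier :
    Integrable (FourierTransform.fourier (fun s : ℝ => ((s ^ 2 * f s : ℝ) : ℂ)) : ℝ → ℂ)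

/-- The Cauchy transform `Q[λ](z) = ∫ i / (π (z - s)) dλ(s)` on the upper half-plane. -/
def lineCauchy (lam : Measure ℝ) (z : ℂ) : ℂ :=
  ∫ s : ℝ, Complex.I / ((Real.pi : ℂ) * (z - (s : ℂ))) ∂lam

/-- The Hilbert transform of `λ` exists at `t` and equals `h`:
`Im Q[λ](t + iε) → h` as `ε → 0⁺`. -/
def HasLineHilbert (lam : Measure ℝ) (t h : ℝ) : Prop :=
  Tendsto (fun ε : ℝ => (lineCauchy lam ((t : ℂ) + (ε : ℂ) * Complex.I)).im) (𝓝[>] 0) (𝓝 h)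

/-- The Hilbert transform `H[λ](t) = lim_{ε → 0⁺} Im Q[λ](t + iε)`, meaningful wherever the limit
exists. -/
def lineHilbert (lam : Measure ℝ) (t : ℝ) : ℝ :=
  limUnder (𝓝[>] (0 : ℝ))
    (fun ε : ℝ => (lineCauchy lam ((t : ℂ) + (ε : ℂ) * Complex.I)).im)

/-- `𝓑[λ, c₀, c₁] = (μ, ζ₀, ζ₁)`: both measures lie in the weighted class of order one, `ζ₁ ≥ 0`,
and `(Q[λ](z) - iπ⁻¹(c₀ + c₁z)) (Q[μ](z) - iπ⁻¹(ζ₀ + ζ₁z)) = 1` on the upper half-plane. -/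
structure IsInterconversion (lam : Measure ℝ) (c₀ c₁ : ℝ) (μ : Measure ℝ) (ζ₀ ζ₁ : ℝ) :
    Prop where
  mem_left : MemWeighted 1 lam
  mem_right : MemWeighted 1 μ
  nonneg_left : 0 ≤ c₁
  nonneg_right : 0 ≤ ζ₁
  mul_eq_one : ∀ z : ℂ, 0 < z.im →
    (lineCauchy lam z - Complex.I * (Real.pi : ℂ)⁻¹ * ((c₀ : ℂ) + (c₁ : ℂ) * z)) *
      (lineCauchy μ z - Complex.I * (Real.pi : ℂ)⁻¹ * ((ζ₀ : ℂ) + (ζ₁ : ℂ) * z)) = 1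

/-- The zero set `N₀(λ) = ⋂_{ε > 0} clos {s | limsup_{δ → 0⁺} λ[s - δ, s + δ] / (2δ) < ε}`. -/
def densityZeroSet (lam : Measure ℝ) : Set ℝ :=
  ⋂ ε : ℝ, ⋂ _ : 0 < ε, closure {s : ℝ |
    limsup (fun δ : ℝ => lam (Set.Icc (s - δ) (s + δ)) / ENNReal.ofReal (2 * δ)) (𝓝[>] 0)
      < ENNReal.ofReal ε}

/-- The points where `H[λ](s)` exists and `H[λ](s) - π⁻¹ (c₁ s + c₀) = 0`. -/
def hilbertLevelSet (lam : Measure ℝ) (c₀ c₁ : ℝ) : Set ℝ :=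
  {s : ℝ | HasLineHilbert lam s (Real.pi⁻¹ * (c₁ * s + c₀))}

/-- The set `Z' = (N₀(λ) ∩ supp λ) ∪ {s ∉ supp λ | H[λ](s) - π⁻¹ (c₁ s + c₀) = 0}`. -/
def candidateSet (lam : Measure ℝ) (c₀ c₁ : ℝ) : Set ℝ :=
  (densityZeroSet lam ∩ lam.support) ∪ (hilbertLevelSet lam c₀ c₁ \ lam.support)

/-- The set `Z = N₀(λ) ∩ {s | H[λ](s) - π⁻¹ (c₁ s + c₀) = 0}`. -/
def atomSet (lam : Measure ℝ) (c₀ c₁ : ℝ) : Set ℝ :=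
  densityZeroSet lam ∩ hilbertLevelSet lam c₀ c₁

/-- A set of reals is discrete if it contains none of its limit points. -/
def ContainsNoLimitPoint (S : Set ℝ) : Prop :=
  ∀ s ∈ S, ¬ AccPt s (𝓟 S)

/-- The Lebesgue density `λ_c` of the absolutely continuous part of `λ`. -/
def acDensity (lam : Measure ℝ) (s : ℝ) : ℝ :=
  (lam.rnDeriv volume s).toReal

/-- The density `μ_c = λ_c / (λ_c² + (H[λ] - π⁻¹ (c₁ s + c₀))²)`. -/
def interconvertedDensity (lam : Measure ℝ) (c₀ c₁ s : ℝ) : ℝ :=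
  acDensity lam s /
    (acDensity lam s ^ 2 + (lineHilbert lam s - Real.pi⁻¹ * (c₁ * s + c₀)) ^ 2)

/-- The weight `β = π² (c₁ + ∫ dλ(τ) / (τ - α)²)⁻¹`, computed in `[0, ∞]`: the integrand is `∞` at
`τ = α`, and the weight is zero when the integral diverges. -/
def atomWeight (lam : Measure ℝ) (c₁ α : ℝ) : ENNReal :=
  ENNReal.ofReal (Real.pi ^ 2) *
    (ENNReal.ofReal c₁ + ∫⁻ τ : ℝ, (ENNReal.ofReal ((τ - α) ^ 2))⁻¹ ∂lam)⁻¹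

end

/-! Write F(z) = Q[λ](z) - iπ⁻¹(c₀ + c₁z), which is `affineCauchy`. Since λ ≠ 0 and c₁ ≥ 0, Re F > 0
on the upper half-plane, so 1/F is holomorphic there with positive real part. The triple is the
Herglotz representation of 1/F, and the closed form is read off from boundary values.

Existence. By `exists_eq_lineCauchy`, a holomorphic function with non-negative real part that is
O(1/y) at iy is the Cauchy transform of a finite measure. It remains to choose ζ₀, ζ₁ so that 1/F +
iπ⁻¹(ζ₀ + ζ₁z) has both properties (`exists_affine_coefficients`). The expansion of F along the
imaginary axis dictates the choice: F grows linearly if c₁ ≠ 0, tends to a non-zero constant if c₁ =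
0 ≠ c₀, and decays like ‖λ‖/(πy) if both vanish. The last case needs a second moment of λ, and
positivity there is the Cauchy-Schwarz inequality `normSq_lineCauchy_le`.

Closed form. Let G = 1/F = Q[μ] - iπ⁻¹(ζ₀ + ζ₁z), and approach the line vertically. Almost
everywhere F tends to λ_c + i(H[λ] - π⁻¹(c₁s + c₀)) and Re G to μ_c, so μ_c is the real part of a
reciprocal. Almost everywhere for the singular part of μ, Re G blows up, hence F → 0, which places
the point in Z. The set Z is countable, because it lies in the discrete set Z', so the singular part
is a sum of atoms. The mass at α is the limit of πε Re G(α + iε), governed by the first-order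
vanishing of F at α.

Uniqueness. Along the imaginary axis Q[μ] → 0 for every μ in the weighted class, so ζ₀ and ζ₁ are
forced. The measure is then finite, and the closed form expresses it through λ, c₀ and c₁ alone. -/

/-! ### Herglotz representation on the disc and the half-plane -/

/-- The unit circle parametrised by the angle. -/
noncomputable def unitCirclePoint (θ : ℝ) : Metric.sphere (0 : ℂ) 1 :=
  ⟨circleMap 0 1 θ, circleMap_mem_sphere 0 zero_le_one θ⟩

lemma continuous_unitCirclePoint : Continuous unitCirclePoint :=
  (continuous_circleMap 0 1).subtype_mk _

lemma continuous_poissonKernel_unitCircle {w : ℂ} (hw : w ∈ Metric.ball (0 : ℂ) 1) :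
    Continuous fun ζ : Metric.sphere (0 : ℂ) 1 => (((ζ : ℂ) + w) / ((ζ : ℂ) - w)).re := by
  have hne : ∀ ζ : Metric.sphere (0 : ℂ) 1, (ζ : ℂ) - w ≠ 0 := by
    intro ζ hζ
    have h1 := ζ.2
    rw [sub_eq_zero.1 hζ, mem_sphere_zero_iff_norm] at h1
    simp [h1] at hw
  exact Complex.continuous_re.comp (by fun_prop (disch := exact hne _))

/-- The Poisson integral representation on circles inside the unit disc, as an integral
against a finite measure on the unit circle. -/
lemma exists_finiteMeasure_poisson_of_lt_one {h : ℂ → ℂ}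
    (hd : DifferentiableOn ℂ h (Metric.ball 0 1))
    (hpos : ∀ w ∈ Metric.ball (0 : ℂ) 1, 0 ≤ (h w).re) {r : ℝ} (hr0 : 0 < r) (hr1 : r < 1) :
    ∃ ν : FiniteMeasure (Metric.sphere (0 : ℂ) 1), ∀ w ∈ Metric.ball (0 : ℂ) 1,
      ∫ ζ : Metric.sphere (0 : ℂ) 1, (((ζ : ℂ) + w) / ((ζ : ℂ) - w)).re ∂(ν : Measure _)
        = (h (r * w)).re := by
  have hmem : ∀ w ∈ Metric.closedBall (0 : ℂ) 1, (r : ℂ) * w ∈ Metric.ball (0 : ℂ) 1 := by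
    intro w hw
    simp only [mem_closedBall_zero_iff, mem_ball_zero_iff] at hw ⊢
    rw [norm_mul, Complex.norm_real, Real.norm_of_nonneg hr0.le]
    nlinarith [norm_nonneg w]
  have hmaps : Set.MapsTo (fun w : ℂ => (r : ℂ) * w) (Metric.closedBall 0 1)
      (Metric.ball 0 1) := hmem
  have hc : ContinuousOn (fun w : ℂ => h (r * w)) (Metric.closedBall 0 1) :=
    hd.continuousOn.comp (by fun_prop) hmaps
  have hdc : DiffContOnCl ℂ (fun w : ℂ => h (r * w)) (Metric.ball 0 1) := by
    refine ⟨hd.comp (by fun_prop) (hmaps.mono_left Metric.ball_subset_closedBall), ?_⟩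
    rwa [closure_ball _ one_ne_zero]
  set p : ℝ → ℝ := fun θ => (2 * Real.pi)⁻¹ * (h (r * circleMap 0 1 θ)).re with hp
  have hpc : Continuous p := by
    have : Continuous fun θ => h (r * circleMap 0 1 θ) :=
      hc.comp_continuous (continuous_circleMap 0 1)
        (fun θ => Metric.sphere_subset_closedBall (circleMap_mem_sphere 0 zero_le_one θ))
    exact continuous_const.mul (Complex.continuous_re.comp this)
  have hp0 : ∀ θ, 0 ≤ p θ := fun θ => mul_nonneg (by positivity)
    (hpos _ (hmem _ (Metric.sphere_subset_closedBall (circleMap_mem_sphere 0 zero_le_one θ))))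
  have hpm : Measurable fun θ => ENNReal.ofReal (p θ) := hpc.measurable.ennreal_ofReal
  set κ : Measure ℝ := (volume.restrict (Set.Ioc 0 (2 * Real.pi))).withDensity
    (fun θ => ENNReal.ofReal (p θ)) with hκ
  have hfin : IsFiniteMeasure κ := by
    refine isFiniteMeasure_withDensity_ofReal ?_
    exact (hpc.integrableOn_Ioc (a := 0) (b := 2 * Real.pi)).2
  have hmeas : Measurable unitCirclePoint := continuous_unitCirclePoint.measurable
  refine ⟨⟨κ.map unitCirclePoint, inferInstance⟩, fun w hw => ?_⟩
  have hkc := continuous_poissonKernel_unitCircle hw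
  change ∫ ζ : Metric.sphere (0 : ℂ) 1, (((ζ : ℂ) + w) / ((ζ : ℂ) - w)).re
    ∂(κ.map unitCirclePoint) = _
  rw [integral_map hmeas.aemeasurable hkc.aestronglyMeasurable, hκ,
    integral_withDensity_eq_integral_toReal_smul hpm (by simp)]
  have key := hdc.circleAverage_re_herglotzRieszKernel_smul' hw
  simp only [sub_zero] at key
  rw [← key, Real.circleAverage_def, Complex.smul_re,
    intervalIntegral.integral_of_le (by positivity), ← Complex.reCLM_apply,
    ← Complex.reCLM.integral_comp_comm, smul_eq_mul, ← integral_const_mul]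
  · refine integral_congr_ae (Eventually.of_forall fun θ => ?_)
    dsimp only
    rw [ENNReal.toReal_ofReal (hp0 θ)]
    simp only [Complex.reCLM_apply, Complex.smul_re, smul_eq_mul, hp, unitCirclePoint]
    ring
  · have h1 : Continuous fun θ => h (r * circleMap 0 1 θ) :=
      hc.comp_continuous (continuous_circleMap 0 1)
        (fun θ => Metric.sphere_subset_closedBall (circleMap_mem_sphere 0 zero_le_one θ))
    exact ((hkc.comp continuous_unitCirclePoint).smul h1).integrableOn_Ioc

/-- The Herglotz representation of the real part of a holomorphic function on the unit disc. -/
theorem exists_finiteMeasure_re_eq_of_ball {h : ℂ → ℂ}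
    (hd : DifferentiableOn ℂ h (Metric.ball 0 1))
    (hpos : ∀ w ∈ Metric.ball (0 : ℂ) 1, 0 ≤ (h w).re) :
    ∃ ν : FiniteMeasure (Metric.sphere (0 : ℂ) 1), ∀ w ∈ Metric.ball (0 : ℂ) 1,
      (h w).re
        = ∫ ζ : Metric.sphere (0 : ℂ) 1, (((ζ : ℂ) + w) / ((ζ : ℂ) - w)).re ∂(ν : Measure _) := by
  have hr0 : ∀ n : ℕ, (0 : ℝ) < 1 - 1 / ((n : ℝ) + 2) := fun n => by
    rw [sub_pos, div_lt_one (by positivity)]; linarith [n.cast_nonneg (α := ℝ)]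
  have hr1 : ∀ n : ℕ, 1 - 1 / ((n : ℝ) + 2) < 1 := fun n => by
    rw [sub_lt_self_iff]; positivity
  choose ν hν using fun n : ℕ => exists_finiteMeasure_poisson_of_lt_one hd hpos (hr0 n) (hr1 n)
  have hzero : (0 : ℂ) ∈ Metric.ball (0 : ℂ) 1 := by simp
  -- At the centre the Poisson kernel is 1, so all the dilated measures share the mass Re h(0). This
  -- uniform bound is what makes weak compactness applicable.
  have hmass : ∀ n, ((ν n).mass : ℝ) = (h 0).re := by
    intro n
    have h1 := hν n 0 hzero
    have h2 : ∀ ζ : Metric.sphere (0 : ℂ) 1, (((ζ : ℂ) + 0) / ((ζ : ℂ) - 0)).re = 1 := by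
      intro ζ
      have h3 : (ζ : ℂ) ≠ 0 := by
        intro h0
        have := ζ.2
        rw [h0] at this
        simp at this
      simp [div_self h3]
    simp only [h2, integral_const, smul_eq_mul, mul_one, mul_zero] at h1
    rw [← h1]
    rfl
  -- A limit along an ultrafilter finer than `atTop` replaces the extraction of a weakly convergent
  -- subsequence.
  obtain ⟨μ, -, hμ⟩ := (isCompact_setOfPred_finiteMeasure_le_of_compactSpace
    (Metric.sphere (0 : ℂ) 1) ⟨(h 0).re, hpos 0 hzero⟩).ultrafilter_le_nhds
    ((Ultrafilter.of atTop : Ultrafilter ℕ).map ν) (by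
      rw [Ultrafilter.coe_map, Filter.le_principal_iff, Filter.mem_map]
      exact Filter.univ_mem' fun n => (hmass n).le)
  have hlim : Tendsto ν (Ultrafilter.of atTop : Ultrafilter ℕ) (𝓝 μ) := hμ
  rw [FiniteMeasure.tendsto_iff_forall_integral_tendsto] at hlim
  refine ⟨μ, fun w hw => ?_⟩
  have hkc := continuous_poissonKernel_unitCircle hw
  have h1 := hlim (BoundedContinuousFunction.mkOfCompact ⟨_, hkc⟩)
  simp only [BoundedContinuousFunction.mkOfCompact_apply, ContinuousMap.coe_mk] at h1
  simp only [hν _ w hw] at h1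
  have h2 : Tendsto (fun n : ℕ => (h (((1 - 1 / ((n : ℝ) + 2) : ℝ) : ℂ) * w)).re) atTop
      (𝓝 (h w).re) := by
    have h3 : Tendsto (fun n : ℕ => ((1 - 1 / ((n : ℝ) + 2) : ℝ))) atTop (𝓝 (1 - 0)) := by
      refine tendsto_const_nhds.sub ?_
      have := tendsto_one_div_add_atTop_nhds_zero_nat (𝕜 := ℝ)
      have h4 := this.comp (tendsto_add_atTop_nat 1)
      refine h4.congr fun n => ?_
      simp only [Function.comp_apply]
      push_cast
      ring_nf
    rw [sub_zero] at h3
    have h5 : Tendsto (fun n : ℕ => ((1 - 1 / ((n : ℝ) + 2) : ℝ) : ℂ) * w) atTop (𝓝 w) := by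
      have := ((Complex.continuous_ofReal.tendsto 1).comp h3).mul_const w
      simpa using this
    have h6 : ContinuousAt h w :=
      hd.continuousOn.continuousAt (Metric.isOpen_ball.mem_nhds hw)
    exact (Complex.continuous_re.tendsto _).comp (h6.tendsto.comp h5)
  exact tendsto_nhds_unique (h2.mono_left (Ultrafilter.of_le atTop)) h1

/-- The Herglotz representation of the real part of a holomorphic function with nonnegative real
part on the upper half-plane. -/
theorem exists_measure_re_eq_of_upperHalfPlane {G : ℂ → ℂ}
    (hd : DifferentiableOn ℂ G {z | 0 < z.im}) (hpos : ∀ z : ℂ, 0 < z.im → 0 ≤ (G z).re) :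
    ∃ (σ : Measure ℝ) (b : ℝ), IsFiniteMeasure σ ∧ 0 ≤ b ∧ ∀ z : ℂ, 0 < z.im →
      (G z).re = ∫ s : ℝ, z.im * (1 + s ^ 2) / ((z.re - s) ^ 2 + z.im ^ 2) ∂σ + b * z.im := by
  have him : ∀ w : ℂ, w ∈ Metric.ball (0 : ℂ) 1 → 0 < (Complex.I * (1 + w) / (1 - w)).im := by
    intro w hw
    have h1 : Complex.normSq w < 1 := by
      rw [Complex.normSq_eq_norm_sq]
      have := mem_ball_zero_iff.1 hw
      nlinarith [norm_nonneg w]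
    have h2 : 0 < Complex.normSq (1 - w) := by
      rw [Complex.normSq_pos, sub_ne_zero]
      rintro rfl
      simp at hw
    rw [Complex.div_im, div_sub_div_same]
    refine div_pos ?_ h2
    rw [Complex.normSq_apply] at h1
    simp
    nlinarith
  obtain ⟨ν, hν⟩ := exists_finiteMeasure_re_eq_of_ball
    (h := fun w => G (Complex.I * (1 + w) / (1 - w)))
    (hd.comp (by
      intro w hw
      have : 1 - w ≠ 0 := by
        rw [sub_ne_zero]
        rintro rfl
        simp at hw
      exact DifferentiableAt.differentiableWithinAt (by fun_prop (disch := exact this)))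
      (fun w hw => him w hw)) (fun w hw => hpos _ (him w hw))
  set e : Metric.sphere (0 : ℂ) 1 := ⟨1, by simp⟩
  set c : Metric.sphere (0 : ℂ) 1 → ℝ :=
    fun ζ => (Complex.I * (1 + (ζ : ℂ)) / (1 - (ζ : ℂ))).re with hc
  have hcm : Measurable c := by
    refine Complex.measurable_re.comp ?_
    have : Measurable fun ζ : Metric.sphere (0 : ℂ) 1 => (ζ : ℂ) := measurable_subtype_coe
    fun_prop
  -- The Cayley transform sends ζ = 1 to infinity. That point is removed before pushing the measure
  -- to the line, and its mass becomes the coefficient b of the linear term.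
  refine ⟨((ν : Measure _).restrict {e}ᶜ).map c, (ν : Measure _).real {e}, inferInstance,
    measureReal_nonneg, fun z hz => ?_⟩
  have hzi : z + Complex.I ≠ 0 := by
    intro h0
    have := congrArg Complex.im h0
    simp at this
    linarith
  set w := (z - Complex.I) / (z + Complex.I) with hw
  have hwz : Complex.I * (1 + w) / (1 - w) = z := by
    have h1 : 1 - w = 2 * Complex.I / (z + Complex.I) := by
      rw [hw]; field_simp; ring
    have h2 : 1 + w = 2 * z / (z + Complex.I) := by
      rw [hw]; field_simp; ring
    rw [h1, h2]
    field_simp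
  have hwb : w ∈ Metric.ball (0 : ℂ) 1 := by
    rw [mem_ball_zero_iff, hw, norm_div, div_lt_one (norm_pos_iff.2 hzi)]
    refine lt_of_pow_lt_pow_left₀ 2 (norm_nonneg _) ?_
    rw [← Complex.normSq_eq_norm_sq, ← Complex.normSq_eq_norm_sq, Complex.normSq_apply,
      Complex.normSq_apply]
    simp
    nlinarith
  have hkc := continuous_poissonKernel_unitCircle hwb
  have hint : Integrable (fun ζ : Metric.sphere (0 : ℂ) 1 =>
      (((ζ : ℂ) + w) / ((ζ : ℂ) - w)).re) (ν : Measure _) :=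
    (BoundedContinuousFunction.mkOfCompact ⟨_, hkc⟩).integrable _
  have h1 := hν w hwb
  simp only [hwz] at h1
  rw [h1, ← integral_add_compl₀ (measurableSet_singleton e).nullMeasurableSet hint, add_comm]
  congr 1
  · rw [integral_map hcm.aemeasurable
      (Measurable.aestronglyMeasurable (by fun_prop))]
    refine setIntegral_congr_fun (measurableSet_singleton e).compl fun ζ hζ => ?_
    have hζ1 : 1 - (ζ : ℂ) ≠ 0 := by
      rw [sub_ne_zero]
      intro h0
      exact hζ (Subtype.ext h0.symm)
    have hnorm : (ζ : ℂ).re ^ 2 + (ζ : ℂ).im ^ 2 = 1 := by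
      have h2 := ζ.2
      rw [mem_sphere_zero_iff_norm] at h2
      have h3 := Complex.normSq_eq_norm_sq (ζ : ℂ)
      rw [h2, Complex.normSq_apply] at h3
      linarith
    have hreal : Complex.I * (1 + (ζ : ℂ)) / (1 - (ζ : ℂ)) = (c ζ : ℂ) := by
      refine Complex.ext (by simp [hc]) ?_
      rw [Complex.div_im, div_sub_div_same, Complex.ofReal_im, div_eq_zero_iff]
      left
      simp
      nlinarith
    have hcI : (c ζ : ℂ) + Complex.I ≠ 0 := by
      intro h0
      have := congrArg Complex.im h0
      simp at this
    have hζc : (ζ : ℂ) = ((c ζ : ℂ) - Complex.I) / ((c ζ : ℂ) + Complex.I) := by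
      rw [eq_div_iff hcI, ← hreal]
      field_simp
      ring
    have hzc : z - (c ζ : ℂ) ≠ 0 := by
      intro h0
      have := congrArg Complex.im h0
      simp at this
      linarith
    -- The disc kernel in half-plane coordinates. Its real part is Im z (1 + c²) / |z - c|²; at ζ =
    -- 1 the kernel degenerates to -iz, with real part Im z.
    have hk : ((ζ : ℂ) + w) / ((ζ : ℂ) - w)
        = Complex.I * (1 + (c ζ : ℂ) * z) / (z - (c ζ : ℂ)) := by
      have hd1 : (ζ : ℂ) - w = 2 * Complex.I * ((c ζ : ℂ) - z)
          / (((c ζ : ℂ) + Complex.I) * (z + Complex.I)) := by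
        rw [hw, hζc]; field_simp; ring
      have hd2 : (ζ : ℂ) + w = 2 * (1 + (c ζ : ℂ) * z)
          / (((c ζ : ℂ) + Complex.I) * (z + Complex.I)) := by
        rw [hw, hζc]; field_simp; ring_nf; simp; ring
      have hzc' : (c ζ : ℂ) - z ≠ 0 := by rwa [← neg_sub, neg_ne_zero]
      rw [hd1, hd2]
      field_simp
      rw [Complex.I_sq]
      ring
    simp only [hk]
    rw [Complex.div_re, ← add_div, Complex.normSq_apply]
    simp
    congr 1 <;> ring
  · rw [Measure.restrict_singleton, integral_smul_measure, integral_dirac, smul_eq_mul]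
    congr 1
    have h1w : 1 - w = 2 * Complex.I / (z + Complex.I) := by
      rw [hw]; field_simp; ring
    have h2w : 1 + w = 2 * z / (z + Complex.I) := by
      rw [hw]; field_simp; ring
    have : ((e : ℂ) + w) / ((e : ℂ) - w) = - (Complex.I * z) := by
      change (1 + w) / (1 - w) = _
      rw [h1w, h2w]
      field_simp
      rw [Complex.I_sq]
      ring
    rw [this]
    simp

/-! ### The Cauchy kernel and the Cauchy transform of a finite measure -/

lemma cauchyKernel_re (z : ℂ) (s : ℝ) :
    (Complex.I / ((Real.pi : ℂ) * (z - s))).re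
      = Real.pi⁻¹ * (z.im / ((z.re - s) ^ 2 + z.im ^ 2)) := by
  rw [← div_div, div_eq_mul_inv Complex.I, ← Complex.ofReal_inv, mul_comm Complex.I, mul_div_assoc,
    Complex.re_ofReal_mul, Complex.div_re, Complex.normSq_apply]
  simp [pow_two]

lemma cauchyKernel_im (z : ℂ) (s : ℝ) :
    (Complex.I / ((Real.pi : ℂ) * (z - s))).im
      = Real.pi⁻¹ * ((z.re - s) / ((z.re - s) ^ 2 + z.im ^ 2)) := by
  rw [← div_div, div_eq_mul_inv Complex.I, ← Complex.ofReal_inv, mul_comm Complex.I, mul_div_assoc,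
    Complex.im_ofReal_mul, Complex.div_im, Complex.normSq_apply]
  simp [pow_two]

lemma sub_ofReal_ne_zero {z : ℂ} (hz : 0 < z.im) (s : ℝ) : z - s ≠ 0 := by
  intro h0
  have := congrArg Complex.im h0
  simp at this
  linarith

lemma im_le_norm_sub_ofReal (z : ℂ) (s : ℝ) : z.im ≤ ‖z - s‖ := by
  have := Complex.im_le_norm (z - s)
  simpa using this

lemma norm_cauchyKernel (z : ℂ) (s : ℝ) :
    ‖Complex.I / ((Real.pi : ℂ) * (z - s))‖ = (Real.pi * ‖z - s‖)⁻¹ := by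
  rw [norm_div, Complex.norm_I, norm_mul, Complex.norm_real,
    Real.norm_of_nonneg Real.pi_pos.le, one_div]

lemma norm_cauchyKernel_le {z : ℂ} (hz : 0 < z.im) (s : ℝ) :
    ‖Complex.I / ((Real.pi : ℂ) * (z - s))‖ ≤ (Real.pi * z.im)⁻¹ := by
  rw [norm_cauchyKernel]
  have := im_le_norm_sub_ofReal z s
  have := Real.pi_pos
  gcongr

lemma measurable_cauchyKernel (z : ℂ) :
    Measurable fun s : ℝ => Complex.I / ((Real.pi : ℂ) * (z - s)) := by
  fun_prop

lemma integrable_cauchyKernel (μ : Measure ℝ) [IsFiniteMeasure μ] {z : ℂ} (hz : 0 < z.im) :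
    Integrable (fun s : ℝ => Complex.I / ((Real.pi : ℂ) * (z - s))) μ :=
  Integrable.of_bound (measurable_cauchyKernel z).aestronglyMeasurable _
    (Eventually.of_forall (norm_cauchyKernel_le hz))

lemma lineCauchy_re_of_integrable {μ : Measure ℝ} {z : ℂ}
    (h : Integrable (fun s : ℝ => Complex.I / ((Real.pi : ℂ) * (z - s))) μ) :
    (lineCauchy μ z).re = Real.pi⁻¹ * ∫ s, z.im / ((z.re - s) ^ 2 + z.im ^ 2) ∂μ := by
  rw [lineCauchy, ← Complex.reCLM_apply, ← Complex.reCLM.integral_comp_comm h,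
    ← integral_const_mul]
  exact integral_congr_ae (Eventually.of_forall fun s => cauchyKernel_re z s)

lemma lineCauchy_re (μ : Measure ℝ) [IsFiniteMeasure μ] {z : ℂ} (hz : 0 < z.im) :
    (lineCauchy μ z).re = Real.pi⁻¹ * ∫ s, z.im / ((z.re - s) ^ 2 + z.im ^ 2) ∂μ :=
  lineCauchy_re_of_integrable (integrable_cauchyKernel μ hz)

lemma lineCauchy_im (μ : Measure ℝ) [IsFiniteMeasure μ] {z : ℂ} (hz : 0 < z.im) :
    (lineCauchy μ z).im = Real.pi⁻¹ * ∫ s, (z.re - s) / ((z.re - s) ^ 2 + z.im ^ 2) ∂μ := by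
  rw [lineCauchy, ← Complex.imCLM_apply,
    ← Complex.imCLM.integral_comp_comm (integrable_cauchyKernel μ hz), ← integral_const_mul]
  exact integral_congr_ae (Eventually.of_forall fun s => cauchyKernel_im z s)

lemma norm_lineCauchy_le (μ : Measure ℝ) [IsFiniteMeasure μ] {z : ℂ} (hz : 0 < z.im) :
    ‖lineCauchy μ z‖ ≤ (Real.pi * z.im)⁻¹ * μ.real Set.univ :=
  norm_integral_le_of_norm_le_const (Eventually.of_forall (norm_cauchyKernel_le hz))

lemma differentiableOn_lineCauchy (μ : Measure ℝ) [IsFiniteMeasure μ] :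
    DifferentiableOn ℂ (lineCauchy μ) {z | 0 < z.im} := by
  intro z hz
  have hz' : 0 < z.im := hz
  have him : ∀ w ∈ Metric.ball z (z.im / 2), z.im / 2 < w.im := by
    intro w hw
    have h1 := Complex.abs_im_le_norm (w - z)
    rw [Metric.mem_ball, dist_eq_norm] at hw
    rw [Complex.sub_im, abs_le] at h1
    linarith [h1.1]
  refine (hasDerivAt_integral_of_dominated_loc_of_deriv_le
    (F := fun (w : ℂ) (s : ℝ) => Complex.I / ((Real.pi : ℂ) * (w - s)))
    (F' := fun (w : ℂ) (s : ℝ) => -(Complex.I / ((Real.pi : ℂ) * (w - s) ^ 2)))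
    (bound := fun _ => (Real.pi * (z.im / 2) ^ 2)⁻¹)
    (Metric.ball_mem_nhds z (half_pos hz'))
    (Eventually.of_forall fun w => (measurable_cauchyKernel w).aestronglyMeasurable)
    (integrable_cauchyKernel μ hz') (Measurable.aestronglyMeasurable (by fun_prop))
    (Eventually.of_forall fun s w hw => ?_) (integrable_const _)
    (Eventually.of_forall fun s w hw => ?_)).2.differentiableAt.differentiableWithinAt
  · have h1 := him w hw
    have h2 := im_le_norm_sub_ofReal w s
    rw [norm_neg, norm_div, Complex.norm_I, norm_mul, Complex.norm_real, norm_pow,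
      Real.norm_of_nonneg Real.pi_pos.le, one_div]
    have := Real.pi_pos
    have : z.im / 2 ≤ ‖w - s‖ := by linarith
    gcongr
  · have h0 : w - s ≠ 0 := sub_ofReal_ne_zero (by linarith [him w hw]) s
    have hπ : (Real.pi : ℂ) ≠ 0 := by exact_mod_cast Real.pi_ne_zero
    have h1 : HasDerivAt (fun w : ℂ => (Real.pi : ℂ) * (w - s)) (Real.pi : ℂ) w := by
      simpa using ((hasDerivAt_id w).sub_const (s : ℂ)).const_mul (Real.pi : ℂ)
    have h2 := (hasDerivAt_const w Complex.I).div h1 (mul_ne_zero hπ h0)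
    refine h2.congr_deriv ?_
    field_simp
    ring

/-! ### Poisson integrals and differentiation of measures -/

/-- The ratio `μ [x - r, x + r] / (2 r)`. -/
noncomputable def ballRatio (μ : Measure ℝ) (x r : ℝ) : ENNReal :=
  μ (Metric.closedBall x r) / volume (Metric.closedBall x r)

lemma measurable_ballRatio (μ : Measure ℝ) (x : ℝ) : Measurable (ballRatio μ x) := by
  have h1 : Measurable fun r => μ (Metric.closedBall x r) :=
    Monotone.measurable fun a b hab => measure_mono (Metric.closedBall_subset_closedBall hab)
  have h2 : Measurable fun r => volume (Metric.closedBall x r) :=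
    Monotone.measurable fun a b hab => measure_mono (Metric.closedBall_subset_closedBall hab)
  exact h1.div h2

/-- The layer cake formula for Poisson integrals. -/
lemma lintegral_poisson_eq_lintegral_ballRatio (μ : Measure ℝ) (x : ℝ) {ε : ℝ} (hε : 0 < ε) :
    ∫⁻ s, ENNReal.ofReal (ε / ((x - s) ^ 2 + ε ^ 2)) ∂μ
      = ∫⁻ t in Set.Ioo 0 1, ballRatio μ x (ε * √(1 / t - 1)) *
          ENNReal.ofReal (2 * √(1 / t - 1)) := by
  have h1 : ∀ s, ENNReal.ofReal (ε / ((x - s) ^ 2 + ε ^ 2))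
      = ENNReal.ofReal ε⁻¹ * ENNReal.ofReal (ε ^ 2 / ((x - s) ^ 2 + ε ^ 2)) := by
    intro s
    rw [← ENNReal.ofReal_mul (by positivity)]
    congr 1
    field_simp
  simp_rw [h1]
  rw [lintegral_const_mul _ (by fun_prop), lintegral_eq_lintegral_meas_le μ
    (Eventually.of_forall fun s => by positivity) (by fun_prop)]
  -- The rescaled kernel is at most 1, so its superlevel sets are empty for t > 1.
  have h2 : ∫⁻ t in Set.Ioi (0 : ℝ), μ {s | t ≤ ε ^ 2 / ((x - s) ^ 2 + ε ^ 2)}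
      = ∫⁻ t in Set.Ioo (0 : ℝ) 1, μ {s | t ≤ ε ^ 2 / ((x - s) ^ 2 + ε ^ 2)} := by
    rw [← setLIntegral_congr (Ioo_ae_eq_Ioc (μ := volume) (a := (0 : ℝ)) (b := 1)).symm]
    rw [← Set.Ioc_union_Ioi_eq_Ioi (zero_le_one (α := ℝ)),
      lintegral_union measurableSet_Ioi (Set.Ioc_disjoint_Ioi le_rfl)]
    convert add_zero _
    rw [setLIntegral_congr_fun (g := fun _ => 0) measurableSet_Ioi]
    · simp
    · intro t ht
      dsimp only
      convert measure_empty (μ := μ)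
      ext s
      simp only [Set.mem_ofPred_eq, Set.mem_empty_iff_false, iff_false, not_le]
      refine lt_of_le_of_lt ?_ ht
      rw [div_le_one (by positivity)]
      nlinarith [sq_nonneg (x - s)]
  rw [h2, ← lintegral_const_mul']
  · refine setLIntegral_congr_fun measurableSet_Ioo fun t ht => ?_
    obtain ⟨ht0, ht1⟩ := ht
    have hρ0 : 0 < 1 / t - 1 := by
      rw [sub_pos, lt_div_iff₀ ht0]; linarith
    have hρ : 0 < √(1 / t - 1) := Real.sqrt_pos.2 hρ0
    have h3 : {s | t ≤ ε ^ 2 / ((x - s) ^ 2 + ε ^ 2)}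
        = Metric.closedBall x (ε * √(1 / t - 1)) := by
      ext s
      rw [Set.mem_ofPred_eq, le_div_iff₀ (by positivity), Metric.mem_closedBall, dist_comm,
        Real.dist_eq, ← abs_of_pos (mul_pos hε hρ), ← sq_le_sq, mul_pow, Real.sq_sqrt hρ0.le]
      have h4 : ε ^ 2 * (1 / t - 1) = (ε ^ 2 - t * ε ^ 2) / t := by field_simp
      rw [h4, le_div_iff₀ ht0]
      constructor <;> intro h <;> linarith
    simp only [h3, ballRatio, Real.volume_closedBall]
    rw [ENNReal.div_eq_inv_mul, mul_right_comm, ← ENNReal.ofReal_inv_of_pos (by positivity),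
      ← ENNReal.ofReal_mul (by positivity)]
    congr 2
    field_simp
  · exact ENNReal.ofReal_ne_top

/-- The layer cake formula for Lebesgue measure at ε = 1: every ball ratio is 1 and the Poisson
integral is π. It supplies the integrable majorant and the constant in the vertical limit. -/
lemma lintegral_sqrt_one_div_sub_one :
    ∫⁻ t in Set.Ioo (0 : ℝ) 1, ENNReal.ofReal (2 * √(1 / t - 1)) = ENNReal.ofReal Real.pi := by
  have h1 := lintegral_poisson_eq_lintegral_ballRatio volume 0 one_pos
  have h2 : ∫⁻ s : ℝ, ENNReal.ofReal (1 / ((0 - s) ^ 2 + 1 ^ 2)) = ENNReal.ofReal Real.pi := by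
    rw [← integral_univ_inv_one_add_sq, ofReal_integral_eq_lintegral_ofReal
      integrable_inv_one_add_sq (Eventually.of_forall fun s => by positivity)]
    refine lintegral_congr fun s => ?_
    congr 1
    rw [one_div]
    ring_nf
  rw [← h2, h1]
  refine setLIntegral_congr_fun measurableSet_Ioo fun t ht => ?_
  have hρ0 : 0 < 1 / t - 1 := by
    rw [sub_pos, lt_div_iff₀ ht.1]; linarith [ht.2]
  have hρ : 0 < √(1 / t - 1) := Real.sqrt_pos.2 hρ0
  rw [ballRatio, ENNReal.div_self, one_mul]
  · rw [Real.volume_closedBall]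
    simp only [ne_eq, ENNReal.ofReal_eq_zero, not_le]
    positivity
  · rw [Real.volume_closedBall]
    exact ENNReal.ofReal_ne_top

/-- A Poisson integral converges vertically where the symmetric derivative exists. -/
lemma tendsto_lintegral_poisson (μ : Measure ℝ) [IsFiniteMeasure μ] {x : ℝ} {D : ENNReal}
    (hD : D ≠ ⊤) (h : Tendsto (ballRatio μ x) (𝓝[>] 0) (𝓝 D)) :
    Tendsto (fun ε => ∫⁻ s, ENNReal.ofReal (ε / ((x - s) ^ 2 + ε ^ 2)) ∂μ) (𝓝[>] 0)
      (𝓝 (D * ENNReal.ofReal Real.pi)) := by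
  -- The ratio is bounded over all radii: near 0 by convergence, away from 0 by the total mass. The
  -- layer cake integral uses arbitrarily large radii, so both ranges are needed for domination.
  have hbd : ∃ M : ENNReal, M ≠ ⊤ ∧ ∀ r, 0 < r → ballRatio μ x r ≤ M := by
    have h1 : ∀ᶠ r in 𝓝[>] (0 : ℝ), ballRatio μ x r < D + 1 :=
      h.eventually (gt_mem_nhds (ENNReal.lt_add_right hD one_ne_zero))
    obtain ⟨δ, hδ, h2⟩ := mem_nhdsGT_iff_exists_Ioo_subset.1 h1
    have hδ' : (0 : ℝ) < δ := hδ
    refine ⟨max (D + 1) (μ Set.univ / ENNReal.ofReal (2 * δ)), ?_, fun r hr => ?_⟩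
    · refine (max_lt (ENNReal.add_lt_top.2 ⟨hD.lt_top, ENNReal.one_lt_top⟩) ?_).ne
      refine ENNReal.div_lt_top (measure_ne_top _ _) ?_
      simp only [ne_eq, ENNReal.ofReal_eq_zero, not_le]
      positivity
    · rcases lt_or_ge r δ with hrδ | hrδ
      · exact le_max_of_le_left (h2 ⟨hr, hrδ⟩ : ballRatio μ x r < D + 1).le
      · refine le_max_of_le_right ?_
        rw [ballRatio, Real.volume_closedBall]
        gcongr
        exact Set.subset_univ _
  obtain ⟨M, hM, hMb⟩ := hbd
  have key : Tendsto (fun ε => ∫⁻ t in Set.Ioo (0 : ℝ) 1, ballRatio μ x (ε * √(1 / t - 1)) *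
      ENNReal.ofReal (2 * √(1 / t - 1))) (𝓝[>] 0)
      (𝓝 (∫⁻ t in Set.Ioo (0 : ℝ) 1, D * ENNReal.ofReal (2 * √(1 / t - 1)))) := by
    refine tendsto_lintegral_filter_of_dominated_convergence
      (fun t => M * ENNReal.ofReal (2 * √(1 / t - 1))) (Eventually.of_forall fun ε => ?_) ?_ ?_ ?_
    · exact ((measurable_ballRatio μ x).comp (by fun_prop)).mul (by fun_prop)
    · filter_upwards [self_mem_nhdsWithin] with ε hε
      refine (ae_restrict_iff' measurableSet_Ioo).2 (Eventually.of_forall fun t ht => ?_)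
      have hρ0 : 0 < 1 / t - 1 := by
        rw [sub_pos, lt_div_iff₀ ht.1]; linarith [ht.2]
      gcongr
      exact hMb _ (mul_pos hε (Real.sqrt_pos.2 hρ0))
    · rw [lintegral_const_mul' _ _ hM, lintegral_sqrt_one_div_sub_one]
      exact ENNReal.mul_ne_top hM ENNReal.ofReal_ne_top
    · refine (ae_restrict_iff' measurableSet_Ioo).2 (Eventually.of_forall fun t ht => ?_)
      have hρ0 : 0 < 1 / t - 1 := by
        rw [sub_pos, lt_div_iff₀ ht.1]; linarith [ht.2]
      refine ENNReal.Tendsto.mul_const (h.comp ?_) (Or.inr ENNReal.ofReal_ne_top)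
      refine tendsto_nhdsWithin_iff.2 ⟨?_, ?_⟩
      · have : Tendsto (fun ε : ℝ => ε * √(1 / t - 1)) (𝓝 0) (𝓝 (0 * √(1 / t - 1))) :=
          tendsto_id.mul_const _
        rw [zero_mul] at this
        exact this.mono_left nhdsWithin_le_nhds
      · filter_upwards [self_mem_nhdsWithin] with ε hε
        exact mul_pos hε (Real.sqrt_pos.2 hρ0)
  rw [lintegral_const_mul' _ _ hD, lintegral_sqrt_one_div_sub_one] at key
  refine key.congr' ?_
  filter_upwards [self_mem_nhdsWithin] with ε hε
  exact (lintegral_poisson_eq_lintegral_ballRatio μ x hε).symm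

lemma poisson_le {ε : ℝ} (hε : 0 < ε) (x s : ℝ) : ε / ((x - s) ^ 2 + ε ^ 2) ≤ ε⁻¹ := by
  rw [div_le_iff₀ (by positivity), inv_mul_eq_div, le_div_iff₀ hε]
  nlinarith [sq_nonneg (x - s)]

lemma integrable_poisson (μ : Measure ℝ) [IsFiniteMeasure μ] (x : ℝ) {ε : ℝ} (hε : 0 < ε) :
    Integrable (fun s => ε / ((x - s) ^ 2 + ε ^ 2)) μ := by
  refine Integrable.of_bound (Measurable.aestronglyMeasurable (by fun_prop)) ε⁻¹
    (Eventually.of_forall fun s => ?_)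
  rw [Real.norm_of_nonneg (by positivity)]
  exact poisson_le hε x s

lemma ofReal_integral_poisson (μ : Measure ℝ) [IsFiniteMeasure μ] (x : ℝ) {ε : ℝ} (hε : 0 < ε) :
    ENNReal.ofReal (∫ s, ε / ((x - s) ^ 2 + ε ^ 2) ∂μ)
      = ∫⁻ s, ENNReal.ofReal (ε / ((x - s) ^ 2 + ε ^ 2)) ∂μ :=
  ofReal_integral_eq_lintegral_ofReal (integrable_poisson μ x hε)
    (Eventually.of_forall fun s => by positivity)

/-- Poisson integrals of finite measures converge vertically to the density almost everywhere. -/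
theorem ae_tendsto_integral_poisson (μ : Measure ℝ) [IsFiniteMeasure μ] :
    ∀ᵐ x : ℝ, Tendsto (fun ε => ∫ s, ε / ((x - s) ^ 2 + ε ^ 2) ∂μ) (𝓝[>] 0)
      (𝓝 ((μ.rnDeriv volume x).toReal * Real.pi)) := by
  filter_upwards [Besicovitch.ae_tendsto_rnDeriv μ volume, μ.rnDeriv_lt_top volume] with x hx hx2
  have h1 := tendsto_lintegral_poisson μ hx2.ne hx
  have h2 := (ENNReal.tendsto_toReal (ENNReal.mul_ne_top hx2.ne ENNReal.ofReal_ne_top)).comp h1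
  rw [ENNReal.toReal_mul, ENNReal.toReal_ofReal Real.pi_pos.le] at h2
  refine h2.congr' ?_
  filter_upwards [self_mem_nhdsWithin] with ε hε
  have hε' : (0 : ℝ) < ε := hε
  rw [Function.comp_apply, ← ofReal_integral_poisson μ x hε, ENNReal.toReal_ofReal]
  exact integral_nonneg fun s => by positivity

/-- On the ball of radius ε the kernel is at least 1/(2ε). So ball ratios blow up only where Poisson
integrals do, and vanish in the limit wherever the latter do. -/
lemma ballRatio_le_integral_poisson (μ : Measure ℝ) [IsFiniteMeasure μ] (x : ℝ) {ε : ℝ}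
    (hε : 0 < ε) :
    ballRatio μ x ε ≤ ENNReal.ofReal (∫ s, ε / ((x - s) ^ 2 + ε ^ 2) ∂μ) := by
  rw [ofReal_integral_poisson μ x hε, ballRatio, Real.volume_closedBall, ENNReal.div_eq_inv_mul,
    ← ENNReal.ofReal_inv_of_pos (by positivity), ← setLIntegral_const]
  refine (setLIntegral_mono' Metric.isClosed_closedBall.measurableSet fun s hs => ?_).trans
    (setLIntegral_le_lintegral (Metric.closedBall x ε) _)
  refine ENNReal.ofReal_le_ofReal ?_
  rw [Metric.mem_closedBall, dist_comm, Real.dist_eq, ← abs_of_pos hε, ← sq_le_sq] at hs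
  rw [inv_eq_one_div, div_le_div_iff₀ (by positivity) (by positivity)]
  nlinarith

/-- Poisson integrals blow up vertically almost everywhere for the singular part. -/
theorem ae_singularPart_tendsto_integral_poisson (μ : Measure ℝ) [IsFiniteMeasure μ] :
    ∀ᵐ x ∂(μ.singularPart volume),
      Tendsto (fun ε => ∫ s, ε / ((x - s) ^ 2 + ε ^ 2) ∂μ) (𝓝[>] 0) atTop := by
  -- Lebesgue measure is differentiated against the singular part, with derivative 0. The inverse
  -- ratios therefore tend to infinity.
  have hs : (volume : Measure ℝ).rnDeriv (μ.singularPart volume) =ᵐ[μ.singularPart volume] 0 :=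
    (Measure.rnDeriv_eq_zero _ _).2 (Measure.mutuallySingular_singularPart μ volume).symm
  filter_upwards [Besicovitch.ae_tendsto_rnDeriv volume (μ.singularPart volume), hs] with x hx hx2
  rw [hx2, Pi.zero_apply] at hx
  have h1 := hx.inv
  rw [ENNReal.inv_zero] at h1
  refine ENNReal.tendsto_ofReal_nhds_top.1 (tendsto_nhds_top_mono h1 ?_)
  filter_upwards [self_mem_nhdsWithin] with ε hε
  have hε' : (0 : ℝ) < ε := hε
  refine le_trans ?_ (ballRatio_le_integral_poisson μ x hε)
  rw [ENNReal.inv_div (Or.inl (measure_ne_top _ _)) (Or.inr (by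
    rw [Real.volume_closedBall]
    simp only [ne_eq, ENNReal.ofReal_eq_zero, not_le]
    positivity)), ballRatio]
  gcongr
  exact Measure.singularPart_le μ volume

/-! ### Almost everywhere boundary values and the Hilbert transform -/

/-- A holomorphic function with nonnegative real part on the upper half-plane has vertical limits
of its real part almost everywhere. -/
theorem ae_exists_tendsto_re {G : ℂ → ℂ}
    (hd : DifferentiableOn ℂ G {z | 0 < z.im}) (hpos : ∀ z : ℂ, 0 < z.im → 0 ≤ (G z).re) :
    ∀ᵐ x : ℝ, ∃ l : ℝ,
      Tendsto (fun ε : ℝ => (G ((x : ℂ) + (ε : ℂ) * Complex.I)).re) (𝓝[>] 0) (𝓝 l) := by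
  obtain ⟨σ, b, hσ, -, hG⟩ := exists_measure_re_eq_of_upperHalfPlane hd hpos
  filter_upwards [ae_tendsto_integral_poisson σ] with x hx
  -- The numerator is split as 1 + s² = (1 + x²) + (s - x)(s + x). The first piece is a plain
  -- Poisson integral; the second vanishes pointwise as ε → 0 and is bounded uniformly in s, hence
  -- contributes nothing.
  have hb : ∀ {ε : ℝ}, 0 < ε → ∀ s : ℝ,
      ‖ε * (s - x) * (s + x) / ((x - s) ^ 2 + ε ^ 2)‖ ≤ |x| + ε := by
    intro ε hε s
    rw [norm_div, Real.norm_of_nonneg (by positivity : 0 ≤ (x - s) ^ 2 + ε ^ 2),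
      div_le_iff₀ (by positivity), norm_mul, norm_mul, Real.norm_of_nonneg hε.le,
      Real.norm_eq_abs, Real.norm_eq_abs]
    have h3 : |s + x| ≤ |s - x| + 2 * |x| := by
      calc |s + x| = |(s - x) + 2 * x| := by ring_nf
        _ ≤ |s - x| + |2 * x| := abs_add_le _ _
        _ = _ := by rw [abs_mul, abs_two]
    have h4 : (x - s) ^ 2 = |s - x| ^ 2 := by rw [sq_abs]; ring
    rw [h4]
    have h5 : ε * |s - x| * |s + x| ≤ ε * |s - x| * (|s - x| + 2 * |x|) := by gcongr
    nlinarith [abs_nonneg (s - x), abs_nonneg x, sq_nonneg (|s - x| - ε),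
      mul_nonneg (abs_nonneg x) (sq_nonneg (|s - x| - ε)), pow_pos hε 3]
  have h2 : Tendsto (fun ε : ℝ => ∫ s, ε * (s - x) * (s + x) / ((x - s) ^ 2 + ε ^ 2) ∂σ)
      (𝓝[>] 0) (𝓝 (∫ s, (0 : ℝ) ∂σ)) := by
    refine tendsto_integral_filter_of_dominated_convergence (fun _ => |x| + 1)
      (Eventually.of_forall fun ε => Measurable.aestronglyMeasurable (by fun_prop)) ?_
      (integrable_const _) (Eventually.of_forall fun s => ?_)
    · filter_upwards [Ioo_mem_nhdsGT (zero_lt_one (α := ℝ))] with ε hε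
      exact Eventually.of_forall fun s => (hb hε.1 s).trans (by linarith [hε.2])
    · rcases eq_or_ne s x with rfl | hsx
      · simp
      · have h6 : ContinuousAt (fun ε : ℝ => ε * (s - x) * (s + x) / ((x - s) ^ 2 + ε ^ 2)) 0 := by
          have : (x - s) ^ 2 + (0 : ℝ) ^ 2 ≠ 0 := by
            have : x - s ≠ 0 := sub_ne_zero.2 hsx.symm
            positivity
          fun_prop (disch := exact this)
        have h7 := h6.tendsto
        simp only [zero_mul, zero_div] at h7
        exact h7.mono_left nhdsWithin_le_nhds
  have h8 : Tendsto (fun ε : ℝ => b * ε) (𝓝[>] 0) (𝓝 (b * 0)) :=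
    (tendsto_id.const_mul b).mono_left nhdsWithin_le_nhds
  refine ⟨_, (((hx.const_mul (1 + x ^ 2)).add h2).add h8).congr' ?_⟩
  filter_upwards [self_mem_nhdsWithin] with ε hε
  have hε' : (0 : ℝ) < ε := hε
  have him : ((x : ℂ) + (ε : ℂ) * Complex.I).im = ε := by simp
  have hre : ((x : ℂ) + (ε : ℂ) * Complex.I).re = x := by simp
  rw [hG _ (by rw [him]; exact hε), him, hre, ← integral_const_mul]
  congr 1
  have hsum : ∀ s : ℝ, ε * (1 + s ^ 2) / ((x - s) ^ 2 + ε ^ 2)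
      = (1 + x ^ 2) * (ε / ((x - s) ^ 2 + ε ^ 2))
        + ε * (s - x) * (s + x) / ((x - s) ^ 2 + ε ^ 2) := by
    intro s
    field_simp
    ring
  have hi1 : Integrable (fun s => (1 + x ^ 2) * (ε / ((x - s) ^ 2 + ε ^ 2))) σ :=
    (integrable_poisson σ x hε).const_mul _
  have hi2 : Integrable (fun s => ε * (s - x) * (s + x) / ((x - s) ^ 2 + ε ^ 2)) σ := by
    refine Integrable.of_bound (Measurable.aestronglyMeasurable (by fun_prop))
      (|x| + ε) (Eventually.of_forall (hb hε'))
  rw [integral_congr_ae (Eventually.of_forall hsum), integral_add hi1 hi2]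

/-- A continuous real function whose exponential `exp (i b)` converges is itself convergent. -/
lemma exists_tendsto_of_tendsto_exp_mul_I {b : ℝ → ℝ} (hb : ContinuousOn b (Set.Ioi 0)) {u : ℂ}
    (h : Tendsto (fun ε => Complex.exp (b ε * Complex.I)) (𝓝[>] 0) (𝓝 u)) :
    ∃ l, Tendsto b (𝓝[>] 0) (𝓝 l) := by
  have hu : ‖u‖ = 1 := by
    refine tendsto_nhds_unique h.norm ?_
    simp only [Complex.norm_exp_ofReal_mul_I]
    exact tendsto_const_nhds
  have huarg : Complex.exp (u.arg * Complex.I) = u := by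
    have := Complex.norm_mul_exp_arg_mul_I u
    rwa [hu, Complex.ofReal_one, one_mul] at this
  have hu0 : u ≠ 0 := by
    rw [← norm_ne_zero_iff, hu]; exact one_ne_zero
  set v : ℝ → ℂ := fun ε => Complex.exp (b ε * Complex.I) / u with hv
  have hv1 : Tendsto v (𝓝[>] 0) (𝓝 1) := by
    have := h.div_const u
    rwa [div_self hu0] at this
  obtain ⟨δ, hδ, hδv⟩ := mem_nhdsGT_iff_exists_Ioo_subset.1
    (hv1.eventually (Complex.isOpen_slitPlane.mem_nhds Complex.one_mem_slitPlane))
  have hδ' : (0 : ℝ) < δ := hδ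
  have hvc : ContinuousOn v (Set.Ioo 0 δ) := by
    have hb' : ContinuousOn b (Set.Ioo 0 δ) := hb.mono Set.Ioo_subset_Ioi_self
    exact (Complex.continuous_exp.comp_continuousOn
      ((Complex.continuous_ofReal.comp_continuousOn hb').mul continuousOn_const)).div_const u
  have hac : ContinuousOn (fun ε => (v ε).arg) (Set.Ioo 0 δ) := fun ε hε =>
    ((Complex.continuousAt_arg (hδv hε)).comp_continuousWithinAt (hvc ε hε))
  -- Near 0 the phase b differs from arg u + arg v by 2π times an integer. This integer depends
  -- continuously on ε, so it is constant, and arg v → 0.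
  have hkc : ContinuousOn (fun ε => (b ε - u.arg - (v ε).arg) / (2 * Real.pi)) (Set.Ioo 0 δ) :=
    (((hb.mono Set.Ioo_subset_Ioi_self).sub continuousOn_const).sub hac).div_const _
  have hkm : Set.MapsTo (fun ε => (b ε - u.arg - (v ε).arg) / (2 * Real.pi)) (Set.Ioo 0 δ)
      (Set.range ((↑) : ℤ → ℝ)) := by
    intro ε _
    have hvn : ‖v ε‖ = 1 := by
      rw [hv, norm_div, Complex.norm_exp_ofReal_mul_I, hu, div_one]
    have h1 := Complex.norm_mul_exp_arg_mul_I (v ε)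
    rw [hvn, Complex.ofReal_one, one_mul] at h1
    have h2 : Complex.exp ((b ε - u.arg : ℝ) * Complex.I) = Complex.exp ((v ε).arg * Complex.I) := by
      rw [h1, hv, Complex.ofReal_sub, sub_mul, Complex.exp_sub, huarg]
    obtain ⟨n, hn⟩ := Complex.exp_eq_exp_iff_exists_int.1 h2
    refine ⟨n, ?_⟩
    have h3 := congrArg Complex.im hn
    simp at h3
    rw [eq_div_iff (by positivity)]
    linarith
  have hdis : IsDiscrete (Set.range ((↑) : ℤ → ℝ)) := by
    exact Int.isClosedEmbedding_coe_real.isEmbedding.isDiscrete_range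
  have hmid : δ / 2 ∈ Set.Ioo 0 δ := ⟨by positivity, by linarith⟩
  set k := (b (δ / 2) - u.arg - (v (δ / 2)).arg) / (2 * Real.pi) with hk
  refine ⟨u.arg + k * (2 * Real.pi), ?_⟩
  have ha : Tendsto (fun ε => (v ε).arg) (𝓝[>] 0) (𝓝 (1 : ℂ).arg) :=
    (Complex.continuousAt_arg Complex.one_mem_slitPlane).tendsto.comp hv1
  rw [Complex.arg_one] at ha
  have h4 : Tendsto (fun ε => (v ε).arg + (u.arg + k * (2 * Real.pi))) (𝓝[>] 0)
      (𝓝 (0 + (u.arg + k * (2 * Real.pi)))) := ha.add_const _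
  rw [zero_add] at h4
  refine h4.congr' ?_
  filter_upwards [Ioo_mem_nhdsGT hδ'] with ε hε
  have h5 := isPreconnected_Ioo.constant_of_mapsTo hdis hkc hkm hε hmid
  simp only [← hk] at h5
  rw [div_eq_iff (by positivity)] at h5
  linarith

lemma lineCauchy_re_nonneg (μ : Measure ℝ) [IsFiniteMeasure μ] {z : ℂ} (hz : 0 < z.im) :
    0 ≤ (lineCauchy μ z).re := by
  rw [lineCauchy_re μ hz]
  have := Real.pi_pos
  exact mul_nonneg (by positivity) (integral_nonneg fun s => by positivity)

lemma verticalPoint_im (x ε : ℝ) : ((x : ℂ) + (ε : ℂ) * Complex.I).im = ε := by simp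

lemma verticalPoint_re (x ε : ℝ) : ((x : ℂ) + (ε : ℂ) * Complex.I).re = x := by simp

lemma lineCauchy_re_vertical (μ : Measure ℝ) [IsFiniteMeasure μ] (x : ℝ) {ε : ℝ} (hε : 0 < ε) :
    (lineCauchy μ ((x : ℂ) + (ε : ℂ) * Complex.I)).re
      = Real.pi⁻¹ * ∫ s, ε / ((x - s) ^ 2 + ε ^ 2) ∂μ := by
  rw [lineCauchy_re μ (by rwa [verticalPoint_im]), verticalPoint_im, verticalPoint_re]

theorem ae_tendsto_lineCauchy_re (μ : Measure ℝ) [IsFiniteMeasure μ] :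
    ∀ᵐ x : ℝ, Tendsto (fun ε : ℝ => (lineCauchy μ ((x : ℂ) + (ε : ℂ) * Complex.I)).re) (𝓝[>] 0)
      (𝓝 (acDensity μ x)) := by
  filter_upwards [ae_tendsto_integral_poisson μ] with x hx
  have h1 := hx.const_mul Real.pi⁻¹
  rw [mul_comm _ Real.pi, inv_mul_cancel_left₀ Real.pi_ne_zero] at h1
  refine h1.congr' ?_
  filter_upwards [self_mem_nhdsWithin] with ε hε
  exact (lineCauchy_re_vertical μ x hε).symm

/-- The Hilbert transform of a finite measure exists almost everywhere. -/
theorem ae_hasLineHilbert (μ : Measure ℝ) [IsFiniteMeasure μ] :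
    ∀ᵐ x : ℝ, HasLineHilbert μ x (lineHilbert μ x) := by
  -- Since Re Q ≥ 0, g = exp(-Q) is bounded by 1. Hence 1 - g and 1 + ig have non-negative real
  -- part, which gives vertical limits of Re g and Im g. Multiplying by exp(Re Q) isolates exp(-i Im
  -- Q).
  set g : ℂ → ℂ := fun z => Complex.exp (-lineCauchy μ z) with hg
  have hgd : DifferentiableOn ℂ g {z | 0 < z.im} := (differentiableOn_lineCauchy μ).neg.cexp
  have hg1 : ∀ z : ℂ, 0 < z.im → ‖g z‖ ≤ 1 := by
    intro z hz
    rw [hg, Complex.norm_exp, Complex.neg_re, Real.exp_le_one_iff]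
    linarith [lineCauchy_re_nonneg μ hz]
  have h1 := ae_exists_tendsto_re (G := fun z => 1 - g z) (hgd.const_sub 1) (by
    intro z hz
    have := (Complex.re_le_norm (g z)).trans (hg1 z hz)
    simpa using this)
  have h2 := ae_exists_tendsto_re (G := fun z => 1 + Complex.I * g z)
    ((hgd.const_mul _).const_add 1) (by
      intro z hz
      have := (Complex.abs_im_le_norm (g z)).trans (hg1 z hz)
      simp
      linarith [le_abs_self (g z).im])
  filter_upwards [h1, h2, ae_tendsto_lineCauchy_re μ] with x ⟨a, ha⟩ ⟨c, hc⟩ hx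
  set p : ℝ → ℂ := fun ε => (x : ℂ) + (ε : ℂ) * Complex.I with hp
  have hre : Tendsto (fun ε => (g (p ε)).re) (𝓝[>] 0) (𝓝 (1 - a)) := by
    refine (ha.const_sub 1).congr fun ε => ?_
    simp [hp]
  have him : Tendsto (fun ε => (g (p ε)).im) (𝓝[>] 0) (𝓝 (1 - c)) := by
    refine (hc.const_sub 1).congr fun ε => ?_
    simp [hp]
  have hgl : Tendsto (fun ε => g (p ε)) (𝓝[>] 0) (𝓝 ((1 - a : ℝ) + (1 - c : ℝ) * Complex.I)) := by
    refine (((Complex.continuous_ofReal.tendsto _).comp hre).add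
      (((Complex.continuous_ofReal.tendsto _).comp him).mul_const Complex.I)).congr fun ε => ?_
    exact Complex.re_add_im _
  have hpc : ContinuousOn (fun ε => lineCauchy μ (p ε)) (Set.Ioi 0) := by
    refine (differentiableOn_lineCauchy μ).continuousOn.comp (by fun_prop) fun ε hε => ?_
    simpa [hp] using hε
  have hbc : ContinuousOn (fun ε => -(lineCauchy μ (p ε)).im) (Set.Ioi 0) :=
    (Complex.continuous_im.comp_continuousOn hpc).neg
  have hexp : Tendsto (fun ε => Complex.exp ((-(lineCauchy μ (p ε)).im : ℝ) * Complex.I))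
      (𝓝[>] 0) (𝓝 (((1 - a : ℝ) + (1 - c : ℝ) * Complex.I)
        * Complex.exp (acDensity μ x : ℝ))) := by
    refine (hgl.mul ((Complex.continuous_exp.tendsto _).comp
      ((Complex.continuous_ofReal.tendsto _).comp hx))).congr fun ε => ?_
    simp only [hg, Function.comp_apply]
    rw [← Complex.exp_add]
    congr 1
    refine Complex.ext ?_ ?_ <;> simp [hp]
  obtain ⟨l, hl⟩ := exists_tendsto_of_tendsto_exp_mul_I hbc hexp
  have hl' := hl.neg
  simp only [neg_neg] at hl'
  exact tendsto_nhds_limUnder ⟨_, hl'⟩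

/-! ### Decaying functions as Cauchy transforms of finite measures -/

/-- Fatou's lemma as y → ∞, since y²/(y² + s²) → 1. It converts O(1/y) decay along the imaginary
axis into finiteness of the mass. -/
lemma measure_univ_le_of_eventually_lintegral_le {μ : Measure ℝ} {C : ENNReal}
    (h : ∀ᶠ y : ℝ in atTop, ∫⁻ s, ENNReal.ofReal (y ^ 2 / (y ^ 2 + s ^ 2)) ∂μ ≤ C) :
    μ Set.univ ≤ C := by
  have h1 : ∀ s : ℝ, Tendsto (fun n : ℕ => ENNReal.ofReal ((n : ℝ) ^ 2 / ((n : ℝ) ^ 2 + s ^ 2)))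
      atTop (𝓝 1) := by
    intro s
    rw [← ENNReal.ofReal_one]
    refine ENNReal.tendsto_ofReal ?_
    have h2 : Tendsto (fun n : ℕ => 1 / (1 + s ^ 2 / (n : ℝ) ^ 2)) atTop (𝓝 (1 / (1 + 0))) := by
      refine tendsto_const_nhds.div (tendsto_const_nhds.add ?_) (by norm_num)
      exact (tendsto_const_nhds (x := s ^ 2)).div_atTop
        ((tendsto_pow_atTop two_ne_zero).comp tendsto_natCast_atTop_atTop)
    rw [add_zero, div_one] at h2
    refine h2.congr' ?_
    filter_upwards [eventually_gt_atTop 0] with n hn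
    have : (0 : ℝ) < n := by exact_mod_cast hn
    field_simp
  calc μ Set.univ = ∫⁻ s, 1 ∂μ := by simp
    _ = ∫⁻ s, liminf (fun n : ℕ =>
          ENNReal.ofReal ((n : ℝ) ^ 2 / ((n : ℝ) ^ 2 + s ^ 2))) atTop ∂μ :=
        lintegral_congr fun s => (h1 s).liminf_eq.symm
    _ ≤ liminf (fun n : ℕ =>
          ∫⁻ s, ENNReal.ofReal ((n : ℝ) ^ 2 / ((n : ℝ) ^ 2 + s ^ 2)) ∂μ) atTop :=
        lintegral_liminf_le fun n => by fun_prop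
    _ ≤ C := by
        refine liminf_le_of_frequently_le' (Eventually.frequently ?_)
        exact tendsto_natCast_atTop_atTop.eventually h

lemma isConnected_upperHalfPlane : IsConnected {z : ℂ | 0 < z.im} :=
  ⟨⟨Complex.I, by simp⟩, (convex_halfSpace_im_gt 0).isPreconnected⟩

lemma isOpen_upperHalfPlane : IsOpen {z : ℂ | 0 < z.im} :=
  isOpen_lt continuous_const Complex.continuous_im

lemma tendsto_lineCauchy_imaginary_axis (μ : Measure ℝ) [IsFiniteMeasure μ] :
    Tendsto (fun y : ℝ => lineCauchy μ (y * Complex.I)) atTop (𝓝 0) := by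
  have h1 : Tendsto (fun y : ℝ => (Real.pi * y)⁻¹ * μ.real Set.univ) atTop (𝓝 0) := by
    have := (tendsto_inv_atTop_zero.comp
      (tendsto_id.const_mul_atTop Real.pi_pos)).mul_const (μ.real Set.univ)
    rwa [zero_mul] at this
  refine squeeze_zero_norm' ?_ h1
  filter_upwards [eventually_gt_atTop 0] with y hy
  have := norm_lineCauchy_le μ (z := y * Complex.I) (by simpa using hy)
  simpa using this

lemma tendsto_zero_of_eventually_norm_le_div {g : ℝ → ℂ} {C : ℝ}
    (h : ∀ᶠ y in atTop, ‖g y‖ ≤ C / y) : Tendsto g atTop (𝓝 0) :=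
  squeeze_zero_norm' h (tendsto_const_nhds.div_atTop tendsto_id)

/-- A holomorphic function with nonnegative real part on the upper half-plane that decays along the
imaginary axis is the Cauchy transform of a finite measure. -/
theorem exists_eq_lineCauchy {G : ℂ → ℂ}
    (hd : DifferentiableOn ℂ G {z | 0 < z.im}) (hpos : ∀ z : ℂ, 0 < z.im → 0 ≤ (G z).re)
    {C : ℝ} (hC : ∀ᶠ y : ℝ in atTop, ‖G (y * Complex.I)‖ ≤ C / y) :
    ∃ μ : Measure ℝ, IsFiniteMeasure μ ∧ ∀ z : ℂ, 0 < z.im → G z = lineCauchy μ z := by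
  obtain ⟨σ, b, hσ, hb, hG⟩ := exists_measure_re_eq_of_upperHalfPlane hd hpos
  -- The decay hypothesis multiplied by y. Both terms are non-negative, so the second forces b = 0
  -- and the first bounds the mass of the reweighted measure.
  have hev : ∀ᶠ y : ℝ in atTop,
      y * (∫ s, y * (1 + s ^ 2) / (s ^ 2 + y ^ 2) ∂σ) + b * y ^ 2 ≤ C := by
    filter_upwards [hC, eventually_gt_atTop 0] with y hy hy0
    have h1 := (Complex.re_le_norm _).trans hy
    rw [hG _ (by simpa using hy0), le_div_iff₀ hy0] at h1
    simp only [Complex.re_ofReal_mul, Complex.im_ofReal_mul, Complex.I_re, Complex.I_im, mul_zero,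
      mul_one, zero_sub, neg_sq] at h1
    linarith
  have hint0 : ∀ y : ℝ, 0 < y → 0 ≤ ∫ s, y * (1 + s ^ 2) / (s ^ 2 + y ^ 2) ∂σ :=
    fun y hy => integral_nonneg fun s => by positivity
  have hb0 : b = 0 := by
    by_contra hne
    have hb' : 0 < b := lt_of_le_of_ne hb (Ne.symm hne)
    have h1 : Tendsto (fun y : ℝ => b * y ^ 2) atTop atTop :=
      (tendsto_pow_atTop two_ne_zero).const_mul_atTop hb'
    obtain ⟨y, hy1, hy2, hy3⟩ :=
      (hev.and ((h1.eventually_gt_atTop C).and (eventually_gt_atTop 0))).exists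
    have := mul_nonneg hy3.le (hint0 y hy3)
    linarith
  -- The density π(1 + s²) turns the Herglotz kernel into the real part of the Cauchy kernel.
  set w : ℝ → ENNReal := fun s => ENNReal.ofReal (Real.pi * (1 + s ^ 2)) with hw
  have hwm : Measurable w := by fun_prop
  have hpi := Real.pi_pos
  have hmass : σ.withDensity w Set.univ ≤ ENNReal.ofReal (Real.pi * C) := by
    refine measure_univ_le_of_eventually_lintegral_le ?_
    filter_upwards [hev, eventually_ge_atTop 1] with y hy hy1
    have hy0 : 0 < y := by linarith
    rw [hb0, zero_mul, add_zero] at hy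
    rw [lintegral_withDensity_eq_lintegral_mul _ hwm (by fun_prop)]
    have h2 : ∀ s : ℝ, (w * fun s => ENNReal.ofReal (y ^ 2 / (y ^ 2 + s ^ 2))) s
        = ENNReal.ofReal (Real.pi * y * (y * (1 + s ^ 2) / (s ^ 2 + y ^ 2))) := by
      intro s
      rw [Pi.mul_apply, hw, ← ENNReal.ofReal_mul (by positivity)]
      congr 1
      rw [add_comm (s ^ 2) (y ^ 2)]
      field_simp
    have h3 : Integrable (fun s : ℝ => y * (1 + s ^ 2) / (s ^ 2 + y ^ 2)) σ := by
      refine Integrable.of_bound (Measurable.aestronglyMeasurable (by fun_prop)) y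
        (Eventually.of_forall fun s => ?_)
      rw [Real.norm_of_nonneg (by positivity), div_le_iff₀ (by positivity)]
      have : 1 + s ^ 2 ≤ s ^ 2 + y ^ 2 := by nlinarith
      gcongr
    rw [lintegral_congr h2, ← ofReal_integral_eq_lintegral_ofReal (h3.const_mul _)
      (Eventually.of_forall fun s => by positivity), integral_const_mul]
    refine ENNReal.ofReal_le_ofReal ?_
    rw [mul_assoc]
    gcongr
  have hfin : IsFiniteMeasure (σ.withDensity w) := ⟨hmass.trans_lt ENNReal.ofReal_lt_top⟩
  refine ⟨σ.withDensity w, hfin, ?_⟩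
  have hre : ∀ z : ℂ, 0 < z.im → (G z).re = (lineCauchy (σ.withDensity w) z).re := by
    intro z hz
    rw [lineCauchy_re _ hz, hG z hz, hb0, zero_mul, add_zero,
      integral_withDensity_eq_integral_toReal_smul hwm (by simp [hw]), ← integral_const_mul]
    refine integral_congr_ae (Eventually.of_forall fun s => ?_)
    simp only [hw, smul_eq_mul]
    rw [ENNReal.toReal_ofReal (by positivity)]
    field_simp
  -- Equal real parts leave only a constant difference, and decay along the imaginary axis makes it
  -- zero.
  have han : AnalyticOnNhd ℂ (fun z => G z - lineCauchy (σ.withDensity w) z) {z | 0 < z.im} :=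
    (hd.sub (differentiableOn_lineCauchy _)).analyticOnNhd isOpen_upperHalfPlane
  obtain ⟨c, hc⟩ := han.eq_const_of_re_eq_const (c₀ := 0) (by
    intro z hz
    simp [hre z hz]) isOpen_upperHalfPlane isConnected_upperHalfPlane
  have hlim := (tendsto_zero_of_eventually_norm_le_div hC).sub
    (tendsto_lineCauchy_imaginary_axis (σ.withDensity w))
  rw [sub_zero] at hlim
  have hc0 : c = 0 := by
    refine tendsto_nhds_unique (f := fun _ : ℝ => c) tendsto_const_nhds (hlim.congr' ?_)
    filter_upwards [eventually_gt_atTop 0] with y hy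
    exact hc (y * Complex.I) (by simpa using hy)
  intro z hz
  have := hc z hz
  rw [hc0] at this
  exact sub_eq_zero.1 this

/-! ### Asymptotics along the imaginary axis and the affine coefficients -/

/-- The Cauchy transform of `λ` with the affine term `-i π⁻¹ (c₀ + c₁ z)` added. -/
noncomputable def affineCauchy (lam : Measure ℝ) (c₀ c₁ : ℝ) (z : ℂ) : ℂ :=
  lineCauchy lam z - Complex.I * (Real.pi : ℂ)⁻¹ * ((c₀ : ℂ) + (c₁ : ℂ) * z)

lemma affineTerm_re (c₀ c₁ : ℝ) (z : ℂ) :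
    (Complex.I * (Real.pi : ℂ)⁻¹ * ((c₀ : ℂ) + (c₁ : ℂ) * z)).re = -(Real.pi⁻¹ * (c₁ * z.im)) := by
  rw [← Complex.ofReal_inv]
  simp

lemma affineTerm_im (c₀ c₁ : ℝ) (z : ℂ) :
    (Complex.I * (Real.pi : ℂ)⁻¹ * ((c₀ : ℂ) + (c₁ : ℂ) * z)).im
      = Real.pi⁻¹ * (c₁ * z.re + c₀) := by
  rw [← Complex.ofReal_inv]
  simp
  ring

lemma affineCauchy_re (lam : Measure ℝ) (c₀ c₁ : ℝ) (z : ℂ) :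
    (affineCauchy lam c₀ c₁ z).re = (lineCauchy lam z).re + Real.pi⁻¹ * (c₁ * z.im) := by
  rw [affineCauchy, Complex.sub_re, affineTerm_re, sub_neg_eq_add]

lemma affineCauchy_im (lam : Measure ℝ) (c₀ c₁ : ℝ) (z : ℂ) :
    (affineCauchy lam c₀ c₁ z).im = (lineCauchy lam z).im - Real.pi⁻¹ * (c₁ * z.re + c₀) := by
  rw [affineCauchy, Complex.sub_im, affineTerm_im]

lemma differentiableOn_affineCauchy (lam : Measure ℝ) [IsFiniteMeasure lam] (c₀ c₁ : ℝ) :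
    DifferentiableOn ℂ (affineCauchy lam c₀ c₁) {z | 0 < z.im} :=
  (differentiableOn_lineCauchy lam).sub (by fun_prop)

lemma lineCauchy_re_pos (lam : Measure ℝ) [IsFiniteMeasure lam] (hne : lam ≠ 0) {z : ℂ}
    (hz : 0 < z.im) : 0 < (lineCauchy lam z).re := by
  rw [lineCauchy_re lam hz]
  refine mul_pos (inv_pos.2 Real.pi_pos) ?_
  rw [integral_pos_iff_support_of_nonneg (fun s => by positivity)
    (integrable_poisson lam z.re hz)]
  have : Function.support (fun s : ℝ => z.im / ((z.re - s) ^ 2 + z.im ^ 2)) = Set.univ :=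
    Set.eq_univ_of_forall fun s => by
      rw [Function.mem_support]
      positivity
  rw [this]
  exact Measure.measure_univ_pos.2 hne

lemma affineCauchy_re_pos (lam : Measure ℝ) [IsFiniteMeasure lam] (hne : lam ≠ 0) {c₀ c₁ : ℝ}
    (hc₁ : 0 ≤ c₁) {z : ℂ} (hz : 0 < z.im) : 0 < (affineCauchy lam c₀ c₁ z).re := by
  rw [affineCauchy_re]
  have := lineCauchy_re_pos lam hne hz
  have := Real.pi_pos
  positivity

lemma affineCauchy_ne_zero (lam : Measure ℝ) [IsFiniteMeasure lam] (hne : lam ≠ 0) {c₀ c₁ : ℝ}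
    (hc₁ : 0 ≤ c₁) {z : ℂ} (hz : 0 < z.im) : affineCauchy lam c₀ c₁ z ≠ 0 := by
  intro h
  have := affineCauchy_re_pos lam hne hc₁ (c₀ := c₀) hz
  rw [h] at this
  exact lt_irrefl _ this

lemma inv_re_nonneg {w : ℂ} (h : 0 ≤ w.re) : 0 ≤ (w⁻¹).re := by
  rw [Complex.inv_re]
  exact div_nonneg h (Complex.normSq_nonneg _)

/-- The Cauchy-Schwarz bound for the Cauchy transform. -/
lemma normSq_lineCauchy_le (lam : Measure ℝ) [IsFiniteMeasure lam] {z : ℂ} (hz : 0 < z.im) :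
    Real.pi * z.im * Complex.normSq (lineCauchy lam z)
      ≤ lam.real Set.univ * (lineCauchy lam z).re := by
  set k : ℝ → ℝ := fun s => ‖Complex.I / ((Real.pi : ℂ) * (z - s))‖ with hk
  have hki : Integrable k lam := (integrable_cauchyKernel lam hz).norm
  -- The squared modulus of the kernel is a multiple of its real part; this turns Cauchy-Schwarz
  -- into a bound of |Q|² by Re Q.
  have hk2 : ∀ s, k s ^ 2 = (Real.pi * z.im)⁻¹
      * (Real.pi⁻¹ * (z.im / ((z.re - s) ^ 2 + z.im ^ 2))) := by
    intro s
    have h1 : ‖z - s‖ ^ 2 = (z.re - s) ^ 2 + z.im ^ 2 := by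
      rw [← Complex.normSq_eq_norm_sq, Complex.normSq_apply]
      simp [pow_two]
    simp only [hk]
    have := Real.pi_pos
    rw [norm_cauchyKernel, inv_pow, mul_pow, h1]
    field_simp
  have hk2i : Integrable (fun s => k s ^ 2) lam := by
    simp_rw [hk2]
    exact ((integrable_poisson lam z.re hz).const_mul _).const_mul _
  have hk2v : ∫ s, k s ^ 2 ∂lam = (Real.pi * z.im)⁻¹ * (lineCauchy lam z).re := by
    simp_rw [hk2]
    rw [integral_const_mul, integral_const_mul, lineCauchy_re lam hz]
  have hle : ‖lineCauchy lam z‖ ≤ ∫ s, k s ∂lam := norm_integral_le_integral_norm _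
  set m := lam.real Set.univ with hm
  set J := ∫ s, k s ∂lam with hJ
  have hm0 : 0 ≤ m := measureReal_nonneg
  -- Cauchy-Schwarz against the constant 1, obtained by expanding ∫ (mk - J)² ≥ 0.
  have hcs : J ^ 2 ≤ m * ∫ s, k s ^ 2 ∂lam := by
    have h1 : 0 ≤ ∫ s, (m * k s - J) ^ 2 ∂lam := integral_nonneg fun s => sq_nonneg _
    have h2 : ∫ s, (m * k s - J) ^ 2 ∂lam
        = m ^ 2 * (∫ s, k s ^ 2 ∂lam) - 2 * m * J * J + J ^ 2 * m := by
      have h3 : ∀ s, (m * k s - J) ^ 2 = m ^ 2 * k s ^ 2 - 2 * m * J * k s + J ^ 2 :=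
        fun s => by ring
      simp_rw [h3]
      rw [integral_add, integral_sub, integral_const_mul, integral_const_mul, integral_const,
        smul_eq_mul, ← hm, mul_comm m (J ^ 2)]
      · exact hk2i.const_mul _
      · exact hki.const_mul _
      · exact (hk2i.const_mul _).sub (hki.const_mul _)
      · exact integrable_const _
    rw [h2] at h1
    rcases hm0.eq_or_lt with h4 | h4
    · have h5 : lam = 0 := by
        rw [hm, Measure.real, eq_comm, ENNReal.toReal_eq_zero_iff] at h4
        rcases h4 with h4 | h4
        · exact Measure.measure_univ_eq_zero.1 h4
        · exact absurd h4 (measure_ne_top _ _)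
      have h6 : J = 0 := by rw [hJ, h5, integral_zero_measure]
      rw [h6, ← h4]
      simp
    · have : 0 ≤ m * (m * (∫ s, k s ^ 2 ∂lam) - J ^ 2) := by nlinarith
      have := nonneg_of_mul_nonneg_right this h4
      linarith
  rw [Complex.normSq_eq_norm_sq]
  have h7 : ‖lineCauchy lam z‖ ^ 2 ≤ m * ((Real.pi * z.im)⁻¹ * (lineCauchy lam z).re) := by
    rw [← hk2v]
    exact (pow_le_pow_left₀ (norm_nonneg _) hle 2).trans hcs
  have hp : 0 < Real.pi * z.im := mul_pos Real.pi_pos hz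
  calc Real.pi * z.im * ‖lineCauchy lam z‖ ^ 2
      ≤ Real.pi * z.im * (m * ((Real.pi * z.im)⁻¹ * (lineCauchy lam z).re)) := by gcongr
    _ = m * (lineCauchy lam z).re := by field_simp

lemma measureReal_univ_pos {lam : Measure ℝ} [IsFiniteMeasure lam] (hne : lam ≠ 0) :
    0 < lam.real Set.univ :=
  ENNReal.toReal_pos (Measure.measure_univ_ne_zero.2 hne) (measure_ne_top _ _)

/-- The second order expansion of the Cauchy transform along the imaginary axis. -/
lemma lineCauchy_imaginary_axis (lam : Measure ℝ) [IsFiniteMeasure lam]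
    (h2 : Integrable (fun s : ℝ => s ^ 2) lam) {y : ℝ} (hy : 0 < y) :
    ∃ R : ℂ, ‖R‖ ≤ (∫ s, s ^ 2 ∂lam) / y ∧
      Real.pi * lineCauchy lam (y * Complex.I)
        = lam.real Set.univ / y - Complex.I * ((∫ s, s ∂lam : ℝ) : ℂ) / y ^ 2 - R / y ^ 2 := by
  have h1 : Integrable (fun s : ℝ => s) lam := by
    refine (h2.add (integrable_const (1 : ℝ))).mono' measurable_id.aestronglyMeasurable
      (Eventually.of_forall fun s => ?_)
    rw [Real.norm_eq_abs, Pi.add_apply, ← sq_abs]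
    nlinarith [sq_nonneg (|s| - 1), abs_nonneg s]
  have hne : ∀ s : ℝ, (y : ℂ) + Complex.I * s ≠ 0 := by
    intro s h0
    have := congrArg Complex.re h0
    simp at this
    exact hy.ne' this
  have hle : ∀ s : ℝ, y ≤ ‖(y : ℂ) + Complex.I * s‖ := by
    intro s
    have := Complex.re_le_norm ((y : ℂ) + Complex.I * s)
    simpa using this
  have hyc : (y : ℂ) ≠ 0 := by exact_mod_cast hy.ne'
  have hπ : (Real.pi : ℂ) ≠ 0 := by exact_mod_cast Real.pi_ne_zero
  have hbd : ∀ s : ℝ, ‖(s : ℂ) ^ 2 / (y + Complex.I * s)‖ ≤ s ^ 2 / y := by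
    intro s
    rw [norm_div, norm_pow, Complex.norm_real, Real.norm_eq_abs, sq_abs]
    have := hle s
    gcongr
  have hRi : Integrable (fun s : ℝ => (s : ℂ) ^ 2 / (y + Complex.I * s)) lam :=
    (h2.div_const y).mono' (Measurable.aestronglyMeasurable (by fun_prop))
      (Eventually.of_forall hbd)
  refine ⟨∫ s : ℝ, (s : ℂ) ^ 2 / (y + Complex.I * s) ∂lam, ?_, ?_⟩
  · rw [← integral_div]
    exact norm_integral_le_of_norm_le (h2.div_const y) (Eventually.of_forall hbd)
  · rw [lineCauchy, ← integral_const_mul]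
    -- The kernel times π is 1/(y + is), expanded as a geometric series to second order with exact
    -- remainder.
    have hk : ∀ s : ℝ, (Real.pi : ℂ) * (Complex.I / (Real.pi * (y * Complex.I - s)))
        = ((1 : ℂ) / y - Complex.I / y ^ 2 * s)
          - (s : ℂ) ^ 2 / (y + Complex.I * s) / y ^ 2 := by
      intro s
      have h3 : (y : ℂ) * Complex.I - s = Complex.I * (y + Complex.I * s) := by
        rw [mul_add, ← mul_assoc, Complex.I_mul_I]; ring
      rw [h3]
      have := hne s
      have hI := Complex.I_ne_zero
      field_simp
      ring_nf
      rw [Complex.I_sq]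
      ring
    rw [integral_congr_ae (Eventually.of_forall hk)]
    have hi1 : Integrable (fun s : ℝ => (s : ℂ)) lam := h1.ofReal
    have hi2 : Integrable (fun s : ℝ => (1 : ℂ) / y - Complex.I / y ^ 2 * s) lam :=
      (integrable_const _).sub (hi1.const_mul _)
    rw [integral_sub hi2 (hRi.div_const _), integral_sub (integrable_const _) (hi1.const_mul _),
      integral_const, integral_div,
      integral_const_mul, integral_complex_ofReal, Complex.real_smul]
    ring

lemma imaginaryAxis_im (y : ℝ) : ((y : ℂ) * Complex.I).im = y := by simp

/-- Re F is at least c₁y/π, so 1/F decays without any correction. -/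
lemma eventually_norm_inv_affineCauchy_le_of_ne_zero (lam : Measure ℝ) [IsFiniteMeasure lam]
    (c₀ : ℝ) {c₁ : ℝ} (hc₁ : 0 < c₁) :
    ∀ᶠ y : ℝ in atTop, ‖(affineCauchy lam c₀ c₁ (y * Complex.I))⁻¹‖ ≤ (Real.pi / c₁) / y := by
  filter_upwards [eventually_gt_atTop 0] with y hy
  have h1 := Complex.re_le_norm (affineCauchy lam c₀ c₁ (y * Complex.I))
  rw [affineCauchy_re, imaginaryAxis_im] at h1
  have h2 := lineCauchy_re_nonneg lam (z := y * Complex.I) (by simpa using hy)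
  have hpi := Real.pi_pos
  have h3 : 0 < Real.pi⁻¹ * (c₁ * y) := by positivity
  have h4 : Real.pi⁻¹ * (c₁ * y) ≤ ‖affineCauchy lam c₀ c₁ (y * Complex.I)‖ := by linarith
  rw [norm_inv]
  calc ‖affineCauchy lam c₀ c₁ (y * Complex.I)‖⁻¹ ≤ (Real.pi⁻¹ * (c₁ * y))⁻¹ := by gcongr
    _ = (Real.pi / c₁) / y := by field_simp

/-- With a = iπ⁻¹c₀ one has F = q - a and q = O(1/y), so 1/F → -1/a. The correction is 1/a, and the
error q/((q - a)a) is O(1/y). -/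
lemma eventually_norm_inv_affineCauchy_sub_le (lam : Measure ℝ) [IsFiniteMeasure lam]
    {c₀ : ℝ} (hc₀ : c₀ ≠ 0) : ∃ C : ℝ, ∀ᶠ y : ℝ in atTop,
      ‖(affineCauchy lam c₀ 0 (y * Complex.I))⁻¹
        + Complex.I * (Real.pi : ℂ)⁻¹ * (((-Real.pi ^ 2 / c₀ : ℝ) : ℂ) + ((0 : ℝ) : ℂ)
          * (y * Complex.I))‖ ≤ C / y := by
  have hpi := Real.pi_pos
  have hc : 0 < |c₀| := abs_pos.2 hc₀
  set m := lam.real Set.univ with hm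
  have hm0 : 0 ≤ m := measureReal_nonneg
  refine ⟨2 * Real.pi * m / |c₀| ^ 2, ?_⟩
  filter_upwards [eventually_gt_atTop 0, eventually_ge_atTop (2 * m / |c₀|)] with y hy hy2
  set q := lineCauchy lam (y * Complex.I) with hq
  have hqn : ‖q‖ ≤ (Real.pi * y)⁻¹ * m := by
    have := norm_lineCauchy_le lam (z := y * Complex.I) (by simpa using hy)
    rwa [imaginaryAxis_im] at this
  set a : ℂ := Complex.I * (Real.pi : ℂ)⁻¹ * c₀ with ha
  have han : ‖a‖ = |c₀| / Real.pi := by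
    rw [ha, norm_mul, norm_mul, Complex.norm_I, norm_inv, Complex.norm_real, Complex.norm_real,
      Real.norm_of_nonneg hpi.le, Real.norm_eq_abs]
    field_simp
  have ha0 : a ≠ 0 := by
    rw [← norm_ne_zero_iff, han]
    positivity
  have hF : affineCauchy lam c₀ 0 (y * Complex.I) = q - a := by
    rw [affineCauchy, ha, hq]; simp
  have hqa : ‖q‖ ≤ ‖a‖ / 2 := by
    refine hqn.trans ?_
    rw [han]
    rw [div_le_iff₀ hc] at hy2
    rw [inv_mul_eq_div, div_div, div_le_div_iff₀ (by positivity) (by positivity)]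
    nlinarith
  have hFn : ‖a‖ / 2 ≤ ‖q - a‖ := by
    have := norm_sub_norm_le a q
    rw [norm_sub_rev] at this
    linarith
  have hF0 : q - a ≠ 0 := by
    rw [← norm_ne_zero_iff]
    have : 0 < ‖a‖ := norm_pos_iff.2 ha0
    exact (by linarith : 0 < ‖q - a‖).ne'
  have hconst : Complex.I * (Real.pi : ℂ)⁻¹ * (((-Real.pi ^ 2 / c₀ : ℝ) : ℂ) + ((0 : ℝ) : ℂ)
          * (y * Complex.I)) = a⁻¹ := by
    have hπ : (Real.pi : ℂ) ≠ 0 := by exact_mod_cast Real.pi_ne_zero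
    have hc' : (c₀ : ℂ) ≠ 0 := by exact_mod_cast hc₀
    have hI := Complex.I_ne_zero
    rw [ha]
    push_cast
    field_simp
    rw [Complex.I_sq]
    simp
  rw [hF, hconst]
  have h5 : (q - a)⁻¹ + a⁻¹ = q / ((q - a) * a) := by
    field_simp
    ring
  rw [h5, norm_div, norm_mul]
  have hapos : 0 < ‖a‖ := norm_pos_iff.2 ha0
  calc ‖q‖ / (‖q - a‖ * ‖a‖) ≤ ((Real.pi * y)⁻¹ * m) / (‖a‖ / 2 * ‖a‖) := by gcongr
    _ = 2 * Real.pi * m / |c₀| ^ 2 / y := by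
      rw [han]
      field_simp

/-- With m = ‖λ‖ and first moment m₁, πq = m/y - im₁/y² + O(y⁻³). Inverting gives 1/q = πy/m +
iπm₁/m² + O(1/y); the affine term cancels the first two terms. -/
lemma eventually_norm_inv_lineCauchy_sub_le (lam : Measure ℝ) [IsFiniteMeasure lam]
    (hne : lam ≠ 0) (h2 : Integrable (fun s : ℝ => s ^ 2) lam) : ∃ C : ℝ, ∀ᶠ y : ℝ in atTop,
      ‖(affineCauchy lam 0 0 (y * Complex.I))⁻¹
        + Complex.I * (Real.pi : ℂ)⁻¹ *
          (((-(Real.pi ^ 2 / (lam.real Set.univ) ^ 2) * ∫ τ : ℝ, τ ∂lam : ℝ) : ℂ)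
            + ((Real.pi ^ 2 / lam.real Set.univ : ℝ) : ℂ) * (y * Complex.I))‖ ≤ C / y := by
  have hpi := Real.pi_pos
  set m := lam.real Set.univ with hm
  have hm0 : 0 < m := measureReal_univ_pos hne
  set m₁ := ∫ τ : ℝ, τ ∂lam with hm1
  set m₂ := ∫ τ : ℝ, τ ^ 2 ∂lam with hm2
  have hm20 : 0 ≤ m₂ := integral_nonneg fun s => sq_nonneg _
  -- K bounds y²|1 + qT|: m₁² is the product of the two first-order terms, and m₂(m + |m₁|) bounds
  -- the remainder R times my + im₁.
  set K := (m₁ ^ 2 + m₂ * (m + |m₁|)) / m ^ 2 with hK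
  refine ⟨2 * Real.pi * K / m, ?_⟩
  filter_upwards [eventually_ge_atTop 1, eventually_ge_atTop (2 * m₂ / m)] with y hy1 hy2
  have hy : 0 < y := by linarith
  obtain ⟨R, hR, hexp⟩ := lineCauchy_imaginary_axis lam h2 hy
  rw [← hm, ← hm1] at hexp
  rw [← hm2] at hR
  set q := lineCauchy lam (y * Complex.I) with hq
  have hF : affineCauchy lam 0 0 (y * Complex.I) = q := by
    rw [affineCauchy]; simp [hq]
  have hπ : (Real.pi : ℂ) ≠ 0 := by exact_mod_cast Real.pi_ne_zero
  have hmc : (m : ℂ) ≠ 0 := by exact_mod_cast hm0.ne'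
  have hyc : (y : ℂ) ≠ 0 := by exact_mod_cast hy.ne'
  have hq0 : q ≠ 0 := by
    have := affineCauchy_ne_zero lam hne (c₀ := 0) le_rfl (z := y * Complex.I) (by simpa using hy)
    rwa [hF] at this
  -- For y ≥ 2m₂/m the remainder costs at most half of the leading term m/y of πq.
  have hqlow : m / (2 * Real.pi * y) ≤ ‖q‖ := by
    have h3 := congrArg Complex.re hexp
    have h4 : ((m : ℂ) / y - Complex.I * (m₁ : ℂ) / y ^ 2 - R / y ^ 2).re
        = m / y - R.re / y ^ 2 := by
      have e1 : (m : ℂ) / y = ((m / y : ℝ) : ℂ) := by push_cast; ring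
      have e2 : Complex.I * (m₁ : ℂ) / y ^ 2 = ((m₁ / y ^ 2 : ℝ) : ℂ) * Complex.I := by
        push_cast; ring
      have e3 : R / (y : ℂ) ^ 2 = ((1 / y ^ 2 : ℝ) : ℂ) * R := by push_cast; ring
      rw [e1, e2, e3, Complex.sub_re, Complex.sub_re, Complex.ofReal_re, Complex.re_ofReal_mul,
        Complex.re_ofReal_mul, Complex.I_re]
      ring
    rw [h4, Complex.re_ofReal_mul] at h3
    have h5 : R.re ≤ m₂ / y := (Complex.re_le_norm R).trans hR
    have h6 : R.re / y ^ 2 ≤ m / (2 * y) := by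
      rw [div_le_iff₀ (by positivity)]
      refine h5.trans ?_
      rw [div_le_iff₀ hm0] at hy2
      rw [div_le_iff₀ hy]
      have : m / (2 * y) * y ^ 2 * y = m * y * y / 2 := by field_simp
      rw [this]
      nlinarith
    have h7 : m / (2 * y) ≤ Real.pi * q.re := by
      rw [h3]
      have : m / y = m / (2 * y) + m / (2 * y) := by field_simp; ring
      linarith
    calc m / (2 * Real.pi * y) = Real.pi⁻¹ * (m / (2 * y)) := by field_simp
      _ ≤ Real.pi⁻¹ * (Real.pi * q.re) := by gcongr
      _ = q.re := by field_simp
      _ ≤ ‖q‖ := Complex.re_le_norm q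
  set T : ℂ := Complex.I * (Real.pi : ℂ)⁻¹ * (((-(Real.pi ^ 2 / m ^ 2) * m₁ : ℝ) : ℂ)
            + ((Real.pi ^ 2 / m : ℝ) : ℂ) * (y * Complex.I)) with hT
  have hTe : T = -((Real.pi : ℂ) / m ^ 2 * (m * y + Complex.I * m₁)) := by
    rw [hT]
    push_cast
    field_simp
    ring_nf
    rw [Complex.I_sq]
    ring
  have hid : 1 + q * T = -((m₁ : ℂ) ^ 2 - R * (m * y + Complex.I * m₁)) / (m ^ 2 * y ^ 2) := by
    have h8 : q * T = -((Real.pi * q) / m ^ 2 * (m * y + Complex.I * m₁)) := by rw [hTe]; ring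
    rw [h8, hexp]
    field_simp
    ring_nf
    rw [Complex.I_sq]
    ring
  have hlin : ‖(m : ℂ) * y + Complex.I * m₁‖ ≤ (m + |m₁|) * y := by
    refine (norm_add_le _ _).trans ?_
    rw [norm_mul, norm_mul, Complex.norm_I, Complex.norm_real, Complex.norm_real,
      Complex.norm_real, Real.norm_of_nonneg hm0.le, Real.norm_of_nonneg hy.le, Real.norm_eq_abs]
    nlinarith [abs_nonneg m₁]
  have hnum : ‖1 + q * T‖ ≤ K / y ^ 2 := by
    rw [hid, norm_div, norm_neg, norm_mul, norm_pow, norm_pow, Complex.norm_real,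
      Complex.norm_real, Real.norm_of_nonneg hm0.le, Real.norm_of_nonneg hy.le, hK, div_div]
    gcongr
    refine (norm_sub_le _ _).trans ?_
    rw [norm_pow, Complex.norm_real, Real.norm_eq_abs, sq_abs, norm_mul]
    have h9 : ‖R‖ * ‖(m : ℂ) * y + Complex.I * m₁‖ ≤ m₂ / y * ((m + |m₁|) * y) := by gcongr
    have h10 : m₂ / y * ((m + |m₁|) * y) = m₂ * (m + |m₁|) := by field_simp
    linarith
  rw [hF]
  have h11 : q⁻¹ + T = (1 + q * T) / q := by field_simp
  have hK0 : 0 ≤ K := by positivity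
  rw [h11, norm_div]
  calc ‖1 + q * T‖ / ‖q‖ ≤ (K / y ^ 2) / (m / (2 * Real.pi * y)) := by gcongr
    _ = 2 * Real.pi * K / m / y := by field_simp

lemma inv_add_affine_re_nonneg_of_eq_zero (lam : Measure ℝ) [IsFiniteMeasure lam]
    (c₀ : ℝ) {c₁ : ℝ} (hc₁ : 0 ≤ c₁) (ζ₀ : ℝ) {z : ℂ} (hz : 0 < z.im) :
    0 ≤ ((affineCauchy lam c₀ c₁ z)⁻¹
      + Complex.I * (Real.pi : ℂ)⁻¹ * ((ζ₀ : ℂ) + ((0 : ℝ) : ℂ) * z)).re := by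
  rw [Complex.add_re, affineTerm_re, zero_mul, mul_zero, neg_zero, add_zero]
  refine inv_re_nonneg ?_
  rw [affineCauchy_re]
  have := lineCauchy_re_nonneg lam hz
  have := Real.pi_pos
  positivity

/-- Re(1/q) = Re q/|q|² is at least π Im z/‖λ‖ by `normSq_lineCauchy_le`, which is exactly what the
linear term subtracts. -/
lemma inv_lineCauchy_add_affine_re_nonneg (lam : Measure ℝ) [IsFiniteMeasure lam]
    (hne : lam ≠ 0) (ζ₀ : ℝ) {z : ℂ} (hz : 0 < z.im) :
    0 ≤ ((affineCauchy lam 0 0 z)⁻¹ + Complex.I * (Real.pi : ℂ)⁻¹ *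
      ((ζ₀ : ℂ) + ((Real.pi ^ 2 / lam.real Set.univ : ℝ) : ℂ) * z)).re := by
  rw [Complex.add_re, affineTerm_re, Complex.inv_re]
  have hF : affineCauchy lam 0 0 z = lineCauchy lam z := by simp [affineCauchy]
  rw [hF]
  have h0 := affineCauchy_ne_zero lam hne (c₀ := 0) le_rfl hz
  rw [hF, ← Complex.normSq_pos] at h0
  have hm := measureReal_univ_pos hne
  have hpi := Real.pi_pos
  have h1 := normSq_lineCauchy_le lam hz
  have h2 : Real.pi⁻¹ * (Real.pi ^ 2 / lam.real Set.univ * z.im)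
      = Real.pi * z.im / lam.real Set.univ := by field_simp
  rw [h2, ← sub_eq_add_neg, sub_nonneg, div_le_div_iff₀ hm h0]
  linarith

/-- The coefficients of the affine term of the interconverted triple. -/
theorem exists_affine_coefficients (lam : Measure ℝ) [IsFiniteMeasure lam]
    (hne : lam ≠ 0) (h2 : Integrable (fun s : ℝ => s ^ 2) lam) (c₀ : ℝ) {c₁ : ℝ} (hc₁ : 0 ≤ c₁) :
    ∃ ζ₀ ζ₁ C : ℝ, 0 ≤ ζ₁ ∧
      (c₁ ≠ 0 → ζ₀ = 0 ∧ ζ₁ = 0) ∧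
      (c₁ = 0 → c₀ ≠ 0 → ζ₁ = 0 ∧ ζ₀ = -Real.pi ^ 2 / c₀) ∧
      (c₀ = 0 → c₁ = 0 →
        ζ₀ = -(Real.pi ^ 2 / (lam.real Set.univ) ^ 2) * ∫ τ : ℝ, τ ∂lam ∧
        ζ₁ = Real.pi ^ 2 / lam.real Set.univ) ∧
      (∀ z : ℂ, 0 < z.im → 0 ≤ ((affineCauchy lam c₀ c₁ z)⁻¹
        + Complex.I * (Real.pi : ℂ)⁻¹ * ((ζ₀ : ℂ) + (ζ₁ : ℂ) * z)).re) ∧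
      ∀ᶠ y : ℝ in atTop, ‖(affineCauchy lam c₀ c₁ (y * Complex.I))⁻¹
        + Complex.I * (Real.pi : ℂ)⁻¹ * ((ζ₀ : ℂ) + (ζ₁ : ℂ) * (y * Complex.I))‖ ≤ C / y := by
  have hm := measureReal_univ_pos hne
  rcases eq_or_ne c₁ 0 with rfl | hc
  · rcases eq_or_ne c₀ 0 with rfl | hc0
    · obtain ⟨C, hC⟩ := eventually_norm_inv_lineCauchy_sub_le lam hne h2
      refine ⟨_, _, C, ?_, fun h => absurd rfl h, fun _ h => absurd rfl h,
        fun _ _ => ⟨rfl, rfl⟩, fun z hz => ?_, hC⟩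
      · positivity
      · exact inv_lineCauchy_add_affine_re_nonneg lam hne _ hz
    · obtain ⟨C, hC⟩ := eventually_norm_inv_affineCauchy_sub_le lam hc0
      exact ⟨_, 0, C, le_rfl, fun h => absurd rfl h, fun _ _ => ⟨rfl, rfl⟩,
        fun h => absurd h hc0,
        fun z hz => inv_add_affine_re_nonneg_of_eq_zero lam c₀ le_rfl _ hz, hC⟩
  · refine ⟨0, 0, Real.pi / c₁, le_rfl, fun _ => ⟨rfl, rfl⟩, fun h => absurd h hc,
      fun _ h => absurd h hc,
      fun z hz => inv_add_affine_re_nonneg_of_eq_zero lam c₀ hc₁ 0 hz, ?_⟩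
    simpa using eventually_norm_inv_affineCauchy_le_of_ne_zero lam c₀
      (lt_of_le_of_ne hc₁ (Ne.symm hc))

/-! ### Existence and uniqueness of the affine coefficients in the weighted class -/

/-- For y ≥ 1 the weight of the class dominates the kernel uniformly in y, so dominated convergence
covers measures of infinite mass. -/
lemma norm_cauchyKernel_imaginary_axis_le {y : ℝ} (hy : 1 ≤ y) (s : ℝ) :
    ‖Complex.I / ((Real.pi : ℂ) * (y * Complex.I - s))‖
      ≤ Real.pi⁻¹ * (1 + s ^ 2) ^ (-(1 : ℝ) / 2) := by
  rw [norm_cauchyKernel, mul_inv]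
  have hpi := Real.pi_pos
  have h1 : √(1 + s ^ 2) ≤ ‖(y : ℂ) * Complex.I - s‖ := by
    refine Real.sqrt_le_iff.2 ⟨norm_nonneg _, ?_⟩
    rw [← Complex.normSq_eq_norm_sq, Complex.normSq_apply]
    simp
    nlinarith
  have h2 : (1 + s ^ 2) ^ (-(1 : ℝ) / 2) = (√(1 + s ^ 2))⁻¹ := by
    rw [neg_div, Real.rpow_neg (by positivity), Real.sqrt_eq_rpow]
  rw [h2]
  have : 0 < √(1 + s ^ 2) := by positivity
  gcongr

lemma MemWeighted.integrable_cauchyKernel {μ : Measure ℝ} (h : MemWeighted 1 μ) {y : ℝ}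
    (hy : 1 ≤ y) :
    Integrable (fun s : ℝ => Complex.I / ((Real.pi : ℂ) * (y * Complex.I - s))) μ :=
  (h.2.const_mul Real.pi⁻¹).mono' (measurable_cauchyKernel _).aestronglyMeasurable
    (Eventually.of_forall (norm_cauchyKernel_imaginary_axis_le hy))

lemma MemWeighted.tendsto_lineCauchy {μ : Measure ℝ} (h : MemWeighted 1 μ) :
    Tendsto (fun y : ℝ => lineCauchy μ (y * Complex.I)) atTop (𝓝 0) := by
  rw [← integral_zero ℝ ℂ (μ := μ)]
  refine tendsto_integral_filter_of_dominated_convergence _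
    (Eventually.of_forall fun y => (measurable_cauchyKernel _).aestronglyMeasurable)
    ((eventually_ge_atTop 1).mono fun y hy =>
      Eventually.of_forall (norm_cauchyKernel_imaginary_axis_le hy))
    (h.2.const_mul Real.pi⁻¹) (Eventually.of_forall fun s => ?_)
  refine tendsto_zero_of_eventually_norm_le_div (C := Real.pi⁻¹) ?_
  filter_upwards [eventually_gt_atTop 0] with y hy
  have := norm_cauchyKernel_le (z := y * Complex.I) (by simpa using hy) s
  rwa [imaginaryAxis_im, mul_inv, ← div_eq_mul_inv] at this

/-- If the affine perturbation of a Cauchy transform decays along the imaginary axis, the affine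
term vanishes. -/
lemma affine_coefficients_eq_zero {a b : ℝ}
    (h : Tendsto (fun y : ℝ => Complex.I * (Real.pi : ℂ)⁻¹ *
      ((a : ℂ) + (b : ℂ) * (y * Complex.I))) atTop (𝓝 0)) : a = 0 ∧ b = 0 := by
  have hpi := Real.pi_pos
  have hre := (Complex.continuous_re.tendsto _).comp h
  have him := (Complex.continuous_im.tendsto _).comp h
  simp only [Function.comp_def, affineTerm_re, affineTerm_im, imaginaryAxis_im, Complex.zero_re,
    Complex.zero_im] at hre him
  constructor
  · have h1 : ∀ y : ℝ, Real.pi⁻¹ * (b * ((y : ℂ) * Complex.I).re + a) = Real.pi⁻¹ * a := by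
      intro y; simp
    simp only [h1] at him
    have := tendsto_nhds_unique tendsto_const_nhds him
    simpa [hpi.ne'] using this
  · have h2 := hre.mul tendsto_inv_atTop_zero
    rw [zero_mul] at h2
    have h3 : Tendsto (fun _ : ℝ => -(Real.pi⁻¹ * b)) atTop (𝓝 0) := by
      refine h2.congr' ?_
      filter_upwards [eventually_ne_atTop 0] with y hy
      field_simp
    have := tendsto_nhds_unique tendsto_const_nhds h3
    simpa [hpi.ne'] using this

/-- A competing triple may a priori carry an infinite measure. Decay bounds its mass by πC, after
which the finite-measure boundary theory applies to it. -/
lemma isFiniteMeasure_of_eventually_lineCauchy_le {μ : Measure ℝ} (h : MemWeighted 1 μ) {C : ℝ}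
    (hC : ∀ᶠ y : ℝ in atTop, ‖lineCauchy μ (y * Complex.I)‖ ≤ C / y) : IsFiniteMeasure μ := by
  refine ⟨lt_of_le_of_lt (measure_univ_le_of_eventually_lintegral_le
    (C := ENNReal.ofReal (Real.pi * C)) ?_) ENNReal.ofReal_lt_top⟩
  have hpi := Real.pi_pos
  filter_upwards [hC, eventually_ge_atTop 1] with y hy hy1
  have hy0 : 0 < y := by linarith
  have hi := h.integrable_cauchyKernel hy1
  have hre := lineCauchy_re_of_integrable hi
  have hi2 : Integrable (fun s : ℝ => Real.pi * y *
      (Complex.I / ((Real.pi : ℂ) * (y * Complex.I - s))).re) μ := hi.re.const_mul _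
  have h1 : ∀ s : ℝ, Real.pi * y * (Complex.I / ((Real.pi : ℂ) * (y * Complex.I - s))).re
      = y ^ 2 / (y ^ 2 + s ^ 2) := by
    intro s
    rw [cauchyKernel_re, imaginaryAxis_im]
    simp only [Complex.re_ofReal_mul, Complex.I_re, mul_zero, zero_sub, neg_sq]
    rw [add_comm (s ^ 2)]
    field_simp
  simp only [h1] at hi2
  rw [← ofReal_integral_eq_lintegral_ofReal hi2 (Eventually.of_forall fun s => by positivity)]
  refine ENNReal.ofReal_le_ofReal ?_
  have h2 : ∫ s, y ^ 2 / (y ^ 2 + s ^ 2) ∂μ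
      = Real.pi * y * (lineCauchy μ (y * Complex.I)).re := by
    rw [hre, imaginaryAxis_im, ← mul_assoc, ← integral_const_mul]
    refine integral_congr_ae (Eventually.of_forall fun s => ?_)
    simp only [Complex.re_ofReal_mul, Complex.I_re, mul_zero, zero_sub, neg_sq]
    rw [add_comm (s ^ 2)]
    field_simp
  rw [h2, mul_assoc]
  have h3 := (Complex.re_le_norm _).trans hy
  rw [le_div_iff₀ hy0] at h3
  have h4 : y * (lineCauchy μ (y * Complex.I)).re ≤ C := by linarith
  gcongr

lemma memWeighted_one_of_isFiniteMeasure (μ : Measure ℝ) [IsFiniteMeasure μ] :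
    MemWeighted 1 μ := by
  refine ⟨inferInstance, Integrable.of_bound (Measurable.aestronglyMeasurable (by fun_prop)) 1
    (Eventually.of_forall fun s => ?_)⟩
  rw [Real.norm_of_nonneg (by positivity)]
  exact Real.rpow_le_one_of_one_le_of_nonpos (by nlinarith [sq_nonneg s]) (by norm_num)

/-- The interconverted triple exists. -/
theorem exists_isInterconversion (lam : Measure ℝ) [IsFiniteMeasure lam] (hne : lam ≠ 0)
    {c₀ c₁ ζ₀ ζ₁ C : ℝ} (hc₁ : 0 ≤ c₁) (hζ₁ : 0 ≤ ζ₁)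
    (hpos : ∀ z : ℂ, 0 < z.im → 0 ≤ ((affineCauchy lam c₀ c₁ z)⁻¹
        + Complex.I * (Real.pi : ℂ)⁻¹ * ((ζ₀ : ℂ) + (ζ₁ : ℂ) * z)).re)
    (hC : ∀ᶠ y : ℝ in atTop, ‖(affineCauchy lam c₀ c₁ (y * Complex.I))⁻¹
        + Complex.I * (Real.pi : ℂ)⁻¹ * ((ζ₀ : ℂ) + (ζ₁ : ℂ) * (y * Complex.I))‖ ≤ C / y) :
    ∃ μ : Measure ℝ, IsInterconversion lam c₀ c₁ μ ζ₀ ζ₁ := by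
  have hd : DifferentiableOn ℂ (fun z => (affineCauchy lam c₀ c₁ z)⁻¹
        + Complex.I * (Real.pi : ℂ)⁻¹ * ((ζ₀ : ℂ) + (ζ₁ : ℂ) * z)) {z | 0 < z.im} :=
    ((differentiableOn_affineCauchy lam c₀ c₁).inv
      fun z hz => affineCauchy_ne_zero lam hne hc₁ hz).add (by fun_prop)
  obtain ⟨μ, hμ, hG⟩ := exists_eq_lineCauchy hd hpos hC
  refine ⟨μ, memWeighted_one_of_isFiniteMeasure lam, memWeighted_one_of_isFiniteMeasure μ, hc₁,
    hζ₁, fun z hz => ?_⟩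
  rw [← hG z hz, add_sub_cancel_right]
  exact mul_inv_cancel₀ (affineCauchy_ne_zero lam hne hc₁ hz)

/-- The affine coefficients of an interconverted triple are unique, and its measure is finite. -/
theorem IsInterconversion.coefficients_eq {lam : Measure ℝ} {c₀ c₁ ζ₀ ζ₁ ζ₀' ζ₁' C : ℝ}
    {μ : Measure ℝ} (h : IsInterconversion lam c₀ c₁ μ ζ₀' ζ₁')
    (hC : ∀ᶠ y : ℝ in atTop, ‖(affineCauchy lam c₀ c₁ (y * Complex.I))⁻¹
        + Complex.I * (Real.pi : ℂ)⁻¹ * ((ζ₀ : ℂ) + (ζ₁ : ℂ) * (y * Complex.I))‖ ≤ C / y) :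
    ζ₀' = ζ₀ ∧ ζ₁' = ζ₁ ∧ IsFiniteMeasure μ := by
  have hinv : ∀ z : ℂ, 0 < z.im → (affineCauchy lam c₀ c₁ z)⁻¹ = lineCauchy μ z
      - Complex.I * (Real.pi : ℂ)⁻¹ * ((ζ₀' : ℂ) + (ζ₁' : ℂ) * z) :=
    fun z hz => inv_eq_of_mul_eq_one_right (h.mul_eq_one z hz)
  have h1 := h.mem_right.tendsto_lineCauchy.sub (tendsto_zero_of_eventually_norm_le_div hC)
  rw [sub_zero] at h1
  -- Both corrected versions of 1/F tend to zero on the imaginary axis, so their affine terms differ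
  -- by something that does too.
  have h2 : Tendsto (fun y : ℝ => Complex.I * (Real.pi : ℂ)⁻¹ *
      (((ζ₀' - ζ₀ : ℝ) : ℂ) + ((ζ₁' - ζ₁ : ℝ) : ℂ) * (y * Complex.I))) atTop (𝓝 0) := by
    refine h1.congr' ?_
    filter_upwards [eventually_gt_atTop 0] with y hy
    rw [hinv _ (by simpa using hy)]
    push_cast
    ring
  obtain ⟨h3, h4⟩ := affine_coefficients_eq_zero h2
  have h5 : ζ₀' = ζ₀ := by linarith
  have h6 : ζ₁' = ζ₁ := by linarith
  subst h5 h6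
  refine ⟨rfl, rfl, isFiniteMeasure_of_eventually_lineCauchy_le h.mem_right (C := C) ?_⟩
  filter_upwards [hC, eventually_gt_atTop 0] with y hy hy0
  rwa [hinv _ (by simpa using hy0), sub_add_cancel] at hy

/-! ### Density, singular part and atoms of the interconverted measure -/

/-- Almost everywhere vertical boundary values of `affineCauchy`. -/
lemma ae_tendsto_affineCauchy (lam : Measure ℝ) [IsFiniteMeasure lam] (c₀ c₁ : ℝ) :
    ∀ᵐ x : ℝ, Tendsto (fun ε : ℝ => affineCauchy lam c₀ c₁ ((x : ℂ) + (ε : ℂ) * Complex.I))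
      (𝓝[>] 0) (𝓝 ((acDensity lam x : ℂ)
        + ((lineHilbert lam x - Real.pi⁻¹ * (c₁ * x + c₀) : ℝ) : ℂ) * Complex.I)) := by
  filter_upwards [ae_tendsto_lineCauchy_re lam, ae_hasLineHilbert lam] with x hx1 hx2
  have h0 : Tendsto (fun ε : ℝ => Real.pi⁻¹ * (c₁ * ε)) (𝓝[>] 0) (𝓝 (Real.pi⁻¹ * (c₁ * 0))) :=
    ((tendsto_id.const_mul c₁).const_mul _).mono_left nhdsWithin_le_nhds
  have hre := hx1.add h0
  rw [mul_zero, mul_zero, add_zero] at hre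
  have him := Tendsto.sub_const hx2 (Real.pi⁻¹ * (c₁ * x + c₀))
  refine (((Complex.continuous_ofReal.tendsto _).comp hre).add
    (((Complex.continuous_ofReal.tendsto _).comp him).mul_const Complex.I)).congr fun ε => ?_
  rw [← Complex.re_add_im (affineCauchy lam c₀ c₁ _), affineCauchy_re, affineCauchy_im,
    verticalPoint_re, verticalPoint_im]
  rfl

/-- Keeps the first-order coefficient of F at α non-zero even when c₁ = 0. -/
lemma lintegral_inv_sq_pos {lam : Measure ℝ} (hne : lam ≠ 0) (α : ℝ) :
    0 < ∫⁻ τ : ℝ, (ENNReal.ofReal ((τ - α) ^ 2))⁻¹ ∂lam := by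
  rw [lintegral_pos_iff_support (by fun_prop)]
  have : Function.support (fun τ : ℝ => (ENNReal.ofReal ((τ - α) ^ 2))⁻¹) = Set.univ :=
    Set.eq_univ_of_forall fun s => by
      rw [Function.mem_support, ENNReal.inv_ne_zero]
      exact ENNReal.ofReal_ne_top
  rw [this]
  exact Measure.measure_univ_pos.2 hne

lemma tendsto_ofReal_one_div_sq_add_sq (α s : ℝ) :
    Tendsto (fun ε : ℝ => ENNReal.ofReal (1 / ((α - s) ^ 2 + ε ^ 2))) (𝓝[>] 0)
      (𝓝 (ENNReal.ofReal ((s - α) ^ 2))⁻¹) := by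
  have h1 : Tendsto (fun ε : ℝ => (α - s) ^ 2 + ε ^ 2) (𝓝[>] 0) (𝓝 ((α - s) ^ 2 + 0 ^ 2)) :=
    ((tendsto_id.pow 2).const_add _).mono_left nhdsWithin_le_nhds
  have h2 : (α - s) ^ 2 + 0 ^ 2 = (s - α) ^ 2 := by ring
  rw [h2] at h1
  refine (ENNReal.tendsto_ofReal h1).inv.congr' ?_
  filter_upwards [self_mem_nhdsWithin] with ε hε
  have hε' : (0 : ℝ) < ε := hε
  rw [one_div, ENNReal.ofReal_inv_of_pos (by positivity)]

section

variable {lam μ : Measure ℝ} [IsFiniteMeasure lam] [IsFiniteMeasure μ] {c₀ c₁ ζ₀ ζ₁ : ℝ}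

/-- The absolutely continuous part of the interconverted measure. -/
lemma ae_acDensity_eq_interconvertedDensity
    (h : ∀ z : ℂ, 0 < z.im → affineCauchy lam c₀ c₁ z * affineCauchy μ ζ₀ ζ₁ z = 1) :
    ∀ᵐ x : ℝ, acDensity μ x = interconvertedDensity lam c₀ c₁ x := by
  filter_upwards [ae_tendsto_affineCauchy lam c₀ c₁, ae_tendsto_affineCauchy μ ζ₀ ζ₁]
    with x h1 h2
  set a := acDensity lam x with ha
  set b := lineHilbert lam x - Real.pi⁻¹ * (c₁ * x + c₀) with hb
  set a' := acDensity μ x with ha'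
  set b' := lineHilbert μ x - Real.pi⁻¹ * (ζ₁ * x + ζ₀) with hb'
  -- The boundary values multiply to 1. In particular that of F is non-zero, so the quotient below
  -- is not a division by zero.
  have h3 : ((a : ℂ) + (b : ℂ) * Complex.I) * ((a' : ℂ) + (b' : ℂ) * Complex.I) = 1 := by
    refine tendsto_nhds_unique (h1.mul h2) (tendsto_const_nhds.congr' ?_)
    filter_upwards [self_mem_nhdsWithin] with ε hε
    exact (h _ (by rw [verticalPoint_im]; exact hε)).symm
  have h4 := congrArg Complex.re (eq_inv_of_mul_eq_one_right h3)
  rw [Complex.inv_re, Complex.normSq_apply] at h4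
  simp only [Complex.add_re, Complex.ofReal_re, Complex.re_ofReal_mul, Complex.I_re, mul_zero,
    add_zero, Complex.add_im, Complex.ofReal_im, Complex.im_ofReal_mul, Complex.I_im, mul_one,
    zero_add] at h4
  rw [h4, interconvertedDensity, ← ha, ← hb]
  ring_nf

/-- A point where `affineCauchy` vanishes vertically belongs to the atom set. -/
lemma mem_atomSet_of_tendsto_zero (hc₁ : 0 ≤ c₁) {x : ℝ}
    (h : Tendsto (fun ε : ℝ => affineCauchy lam c₀ c₁ ((x : ℂ) + (ε : ℂ) * Complex.I))
      (𝓝[>] 0) (𝓝 0)) : x ∈ atomSet lam c₀ c₁ := by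
  have hpi := Real.pi_pos
  have hre := (Complex.continuous_re.tendsto _).comp h
  have him := (Complex.continuous_im.tendsto _).comp h
  simp only [Function.comp_def, affineCauchy_re, affineCauchy_im, Complex.zero_re,
    Complex.zero_im, verticalPoint_re, verticalPoint_im] at hre him
  have hratio : Tendsto (ballRatio lam x) (𝓝[>] 0) (𝓝 0) := by
    have h1 := ENNReal.tendsto_ofReal (hre.const_mul Real.pi)
    rw [mul_zero, ENNReal.ofReal_zero] at h1
    refine tendsto_of_tendsto_of_tendsto_of_le_of_le' tendsto_const_nhds h1
      (Eventually.of_forall fun _ => zero_le) ?_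
    filter_upwards [self_mem_nhdsWithin] with ε hε
    have hε' : (0 : ℝ) < ε := hε
    refine (ballRatio_le_integral_poisson lam x hε').trans (ENNReal.ofReal_le_ofReal ?_)
    rw [lineCauchy_re_vertical lam x hε', mul_add, mul_inv_cancel_left₀ hpi.ne',
      mul_inv_cancel_left₀ hpi.ne']
    have : 0 ≤ c₁ * ε := by positivity
    linarith
  refine ⟨Set.mem_iInter₂.2 fun e he => subset_closure ?_, ?_⟩
  · have h2 : Tendsto (fun δ : ℝ => lam (Set.Icc (x - δ) (x + δ)) / ENNReal.ofReal (2 * δ))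
        (𝓝[>] 0) (𝓝 0) := by
      refine hratio.congr fun δ => ?_
      rw [ballRatio, Real.volume_closedBall, Real.closedBall_eq_Icc]
    rw [Set.mem_ofPred_eq, h2.limsup_eq]
    exact ENNReal.ofReal_pos.2 he
  · have h3 := him.add_const (Real.pi⁻¹ * (c₁ * x + c₀))
    simp only [sub_add_cancel, zero_add] at h3
    exact h3

/-- The singular part of the interconverted measure is carried by the atom set. -/
lemma ae_singularPart_mem_atomSet (hc₁ : 0 ≤ c₁) (hζ₁ : 0 ≤ ζ₁)
    (h : ∀ z : ℂ, 0 < z.im → affineCauchy lam c₀ c₁ z * affineCauchy μ ζ₀ ζ₁ z = 1) :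
    ∀ᵐ x ∂(μ.singularPart volume), x ∈ atomSet lam c₀ c₁ := by
  have hpi := Real.pi_pos
  filter_upwards [ae_singularPart_tendsto_integral_poisson μ] with x hx
  refine mem_atomSet_of_tendsto_zero hc₁ ?_
  -- Re G blows up at such points, and F = 1/G.
  have h1 : Tendsto (fun ε : ℝ => ‖affineCauchy μ ζ₀ ζ₁ ((x : ℂ) + (ε : ℂ) * Complex.I)‖)
      (𝓝[>] 0) atTop := by
    refine tendsto_atTop_mono' _ ?_ (hx.const_mul_atTop (inv_pos.2 hpi))
    filter_upwards [self_mem_nhdsWithin] with ε hε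
    have hε' : (0 : ℝ) < ε := hε
    refine le_trans ?_ (Complex.re_le_norm _)
    rw [affineCauchy_re, lineCauchy_re_vertical μ x hε', verticalPoint_im]
    have : 0 ≤ Real.pi⁻¹ * (ζ₁ * ε) := by positivity
    linarith
  refine tendsto_zero_iff_norm_tendsto_zero.2 ((tendsto_inv_atTop_zero.comp h1).congr' ?_)
  filter_upwards [self_mem_nhdsWithin] with ε hε
  have h2 := h _ (by rw [verticalPoint_im]; exact hε : 0 < ((x : ℂ) + (ε : ℂ) * Complex.I).im)
  rw [eq_inv_of_mul_eq_one_left h2, norm_inv]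
  rfl

/-- The mass of a point is the rescaled vertical limit. -/
lemma tendsto_mul_affineCauchy_re (μ : Measure ℝ) [IsFiniteMeasure μ] (ζ₀ ζ₁ α : ℝ) :
    Tendsto (fun ε : ℝ => Real.pi * (ε *
      (affineCauchy μ ζ₀ ζ₁ ((α : ℂ) + (ε : ℂ) * Complex.I)).re)) (𝓝[>] 0)
      (𝓝 (μ.real {α})) := by
  -- The kernels ε²/((α - s)² + ε²) are at most 1 and converge to the indicator of {α}.
  have h1 : Tendsto (fun ε : ℝ => ∫ s, ε ^ 2 / ((α - s) ^ 2 + ε ^ 2) ∂μ) (𝓝[>] 0)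
      (𝓝 (∫ s, Set.indicator {α} (fun _ => (1 : ℝ)) s ∂μ)) := by
    refine tendsto_integral_filter_of_dominated_convergence (fun _ => 1)
      (Eventually.of_forall fun ε => Measurable.aestronglyMeasurable (by fun_prop)) ?_
      (integrable_const _) (Eventually.of_forall fun s => ?_)
    · filter_upwards [self_mem_nhdsWithin] with ε hε
      have hε' : (0 : ℝ) < ε := hε
      refine Eventually.of_forall fun s => ?_
      rw [Real.norm_of_nonneg (by positivity), div_le_one (by positivity)]
      nlinarith [sq_nonneg (α - s)]
    · by_cases hs : s = α
      · subst hs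
        rw [Set.indicator_of_mem (Set.mem_singleton s)]
        refine tendsto_const_nhds.congr' ?_
        filter_upwards [self_mem_nhdsWithin] with ε hε
        have hε' : (0 : ℝ) < ε := hε
        rw [sub_self]
        field_simp
        simp
      · rw [Set.indicator_of_notMem (by simpa using hs)]
        have h6 : ContinuousAt (fun ε : ℝ => ε ^ 2 / ((α - s) ^ 2 + ε ^ 2)) 0 := by
          have : (α - s) ^ 2 + (0 : ℝ) ^ 2 ≠ 0 := by
            have : α - s ≠ 0 := sub_ne_zero.2 (Ne.symm hs)
            positivity
          fun_prop (disch := exact this)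
        have h7 := h6.tendsto
        simp only [ne_eq, OfNat.ofNat_ne_zero, not_false_eq_true, zero_pow, zero_div] at h7
        exact h7.mono_left nhdsWithin_le_nhds
  rw [integral_indicator_const _ (measurableSet_singleton α), smul_eq_mul, mul_one] at h1
  have h2 : Tendsto (fun ε : ℝ => ζ₁ * ε ^ 2) (𝓝[>] 0) (𝓝 (ζ₁ * 0 ^ 2)) :=
    ((tendsto_id.pow 2).const_mul ζ₁).mono_left nhdsWithin_le_nhds
  have h3 := h1.add h2
  rw [zero_pow two_ne_zero, mul_zero, add_zero] at h3
  refine h3.congr' ?_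
  filter_upwards [self_mem_nhdsWithin] with ε hε
  rw [affineCauchy_re, lineCauchy_re_vertical μ α hε, verticalPoint_im, ← integral_const_mul,
    mul_add, ← integral_const_mul, mul_add, ← integral_const_mul]
  have hpi := Real.pi_pos
  congr 1
  · refine integral_congr_ae (Eventually.of_forall fun s => ?_)
    field_simp
  · field_simp

/-- If `(τ - α)⁻²` is not integrable, `affineCauchy` does not vanish to first order at `α`. -/
lemma tendsto_affineCauchy_re_div_atTop (hc₁ : 0 ≤ c₁) {α : ℝ}
    (hA : ∫⁻ τ : ℝ, (ENNReal.ofReal ((τ - α) ^ 2))⁻¹ ∂lam = ⊤) :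
    Tendsto (fun ε : ℝ => (affineCauchy lam c₀ c₁ ((α : ℂ) + (ε : ℂ) * Complex.I)).re / ε)
      (𝓝[>] 0) atTop := by
  have hpi := Real.pi_pos
  have hi : ∀ ε : ℝ, 0 < ε → Integrable (fun s => 1 / ((α - s) ^ 2 + ε ^ 2)) lam := by
    intro ε hε
    refine ((integrable_poisson lam α hε).div_const ε).congr (Eventually.of_forall fun s => ?_)
    field_simp
  have h1 : Tendsto (fun ε : ℝ => ∫ s, 1 / ((α - s) ^ 2 + ε ^ 2) ∂lam) (𝓝[>] 0) atTop := by
    refine ENNReal.tendsto_ofReal_nhds_top.1 ?_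
    have h2 : Tendsto (fun ε : ℝ => ∫⁻ s, ENNReal.ofReal (1 / ((α - s) ^ 2 + ε ^ 2)) ∂lam)
        (𝓝[>] 0) (𝓝 ⊤) := by
      refine tendsto_of_le_liminf_of_limsup_le ?_ le_top
      -- Fatou's lemma; at s = α the limit of the integrands is ∞, matching the convention in
      -- `atomWeight`.
      calc (⊤ : ENNReal) = ∫⁻ s, liminf (fun ε : ℝ =>
              ENNReal.ofReal (1 / ((α - s) ^ 2 + ε ^ 2))) (𝓝[>] 0) ∂lam := by
            rw [← hA]
            exact lintegral_congr fun s => (tendsto_ofReal_one_div_sq_add_sq α s).liminf_eq.symm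
        _ ≤ _ := lintegral_liminf_le fun ε => by fun_prop
    refine h2.congr' ?_
    filter_upwards [self_mem_nhdsWithin] with ε hε
    have hε' : (0 : ℝ) < ε := hε
    exact (ofReal_integral_eq_lintegral_ofReal (hi ε hε')
      (Eventually.of_forall fun s => by positivity)).symm
  refine tendsto_atTop_mono' _ ?_ (h1.const_mul_atTop (inv_pos.2 hpi))
  filter_upwards [self_mem_nhdsWithin] with ε hε
  have hε' : (0 : ℝ) < ε := hε
  rw [affineCauchy_re, lineCauchy_re_vertical lam α hε', verticalPoint_im, le_div_iff₀ hε',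
    mul_assoc, ← integral_mul_const]
  have h3 : 0 ≤ Real.pi⁻¹ * (c₁ * ε) := by positivity
  have h4 : ∫ s, 1 / ((α - s) ^ 2 + ε ^ 2) * ε ∂lam = ∫ s, ε / ((α - s) ^ 2 + ε ^ 2) ∂lam :=
    integral_congr_ae (Eventually.of_forall fun s => by ring)
  rw [h4]
  linarith

/-- If `(τ - α)⁻²` is integrable and the Hilbert transform at `α` has the critical value, then
`affineCauchy` vanishes to first order at `α`. -/
lemma tendsto_affineCauchy_div {α : ℝ} (hα : α ∈ hilbertLevelSet lam c₀ c₁)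
    (hA : ∫⁻ τ : ℝ, (ENNReal.ofReal ((τ - α) ^ 2))⁻¹ ∂lam ≠ ⊤) :
    Tendsto (fun ε : ℝ => affineCauchy lam c₀ c₁ ((α : ℂ) + (ε : ℂ) * Complex.I) / ε) (𝓝[>] 0)
      (𝓝 ((Real.pi⁻¹ *
        (c₁ + (∫⁻ τ : ℝ, (ENNReal.ofReal ((τ - α) ^ 2))⁻¹ ∂lam).toReal) : ℝ) : ℂ)) := by
  have hpi := Real.pi_pos
  -- The integrand is ∞ at α, so finiteness of the integral excludes an atom of λ there.
  have hne : ∀ᵐ s ∂lam, s ≠ α := by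
    filter_upwards [ae_lt_top (by fun_prop) hA] with s hs h0
    rw [h0] at hs
    simp at hs
  have hcongr : ∀ᵐ s ∂lam,
      (ENNReal.ofReal ((s - α) ^ 2))⁻¹ = ENNReal.ofReal (((α - s) ^ 2)⁻¹) := by
    filter_upwards [hne] with s hs
    have : α - s ≠ 0 := sub_ne_zero.2 hs.symm
    rw [ENNReal.ofReal_inv_of_pos (by positivity), sub_sq_comm]
  rw [lintegral_congr_ae hcongr] at hA ⊢
  set g : ℝ → ℝ := fun s => ((α - s) ^ 2)⁻¹ with hg
  have hg0 : ∀ s, 0 ≤ g s := fun s => by positivity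
  have hgm : Measurable g := by fun_prop
  have hgi : Integrable g lam :=
    (lintegral_ofReal_ne_top_iff_integrable hgm.aestronglyMeasurable
      (Eventually.of_forall hg0)).1 hA
  rw [← integral_eq_lintegral_of_nonneg_ae (Eventually.of_forall hg0) hgm.aestronglyMeasurable]
  have hji : Integrable (fun s => (α - s)⁻¹) lam := by
    refine (hgi.add (integrable_const (1 : ℝ))).mono' (Measurable.aestronglyMeasurable
      (by fun_prop)) (Eventually.of_forall fun s => ?_)
    simp only [Real.norm_eq_abs, Pi.add_apply, hg]
    rw [← inv_pow, ← sq_abs ((α - s)⁻¹)]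
    nlinarith [sq_nonneg (|(α - s)⁻¹| - 1), abs_nonneg ((α - s)⁻¹)]
  have hre : Tendsto (fun ε : ℝ => ∫ s, 1 / ((α - s) ^ 2 + ε ^ 2) ∂lam) (𝓝[>] 0)
      (𝓝 (∫ s, g s ∂lam)) := by
    refine tendsto_integral_filter_of_dominated_convergence g
      (Eventually.of_forall fun ε => Measurable.aestronglyMeasurable (by fun_prop))
      (Eventually.of_forall fun ε => ?_) hgi ?_
    · filter_upwards [hne] with s hs
      have : α - s ≠ 0 := sub_ne_zero.2 hs.symm
      rw [Real.norm_of_nonneg (by positivity), one_div]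
      have : 0 < (α - s) ^ 2 := by positivity
      exact inv_anti₀ this (by nlinarith [sq_nonneg ε])
    · filter_upwards [hne] with s hs
      have hs' : α - s ≠ 0 := sub_ne_zero.2 hs.symm
      have h6 : ContinuousAt (fun ε : ℝ => 1 / ((α - s) ^ 2 + ε ^ 2)) 0 := by
        have : (α - s) ^ 2 + (0 : ℝ) ^ 2 ≠ 0 := by positivity
        fun_prop (disch := exact this)
      have h7 := h6.tendsto
      simp only [ne_eq, OfNat.ofNat_ne_zero, not_false_eq_true, zero_pow, add_zero, one_div] at h7
      simp only [one_div]
      exact h7.mono_left nhdsWithin_le_nhds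
  have him : Tendsto (fun ε : ℝ => ∫ s, -(ε / ((α - s) * ((α - s) ^ 2 + ε ^ 2))) ∂lam) (𝓝[>] 0)
      (𝓝 0) := by
    suffices hsuff : Tendsto (fun ε : ℝ => ∫ s, -(ε / ((α - s) * ((α - s) ^ 2 + ε ^ 2))) ∂lam)
        (𝓝[>] 0) (𝓝 (∫ _, (0 : ℝ) ∂lam)) by rwa [integral_zero] at hsuff
    refine tendsto_integral_filter_of_dominated_convergence g
      (Eventually.of_forall fun ε => Measurable.aestronglyMeasurable (by fun_prop)) ?_ hgi ?_
    · filter_upwards [self_mem_nhdsWithin] with ε hε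
      have hε' : (0 : ℝ) < ε := hε
      filter_upwards [hne] with s hs
      have hs' : α - s ≠ 0 := sub_ne_zero.2 hs.symm
      have habs : 0 < |α - s| := abs_pos.2 hs'
      rw [norm_neg, norm_div, norm_mul, Real.norm_of_nonneg hε'.le, Real.norm_eq_abs,
        Real.norm_of_nonneg (by positivity : 0 ≤ (α - s) ^ 2 + ε ^ 2)]
      change _ ≤ ((α - s) ^ 2)⁻¹
      rw [inv_eq_one_div, ← sq_abs (α - s), div_le_div_iff₀ (by positivity) (by positivity)]
      nlinarith [sq_nonneg (|α - s| - ε), mul_nonneg habs.le (sq_nonneg (|α - s| - ε)),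
        pow_pos habs 3, mul_pos habs (pow_pos hε' 2)]
    · filter_upwards [hne] with s hs
      have hs' : α - s ≠ 0 := sub_ne_zero.2 hs.symm
      have h6 : ContinuousAt (fun ε : ℝ => -(ε / ((α - s) * ((α - s) ^ 2 + ε ^ 2)))) 0 := by
        have : (α - s) * ((α - s) ^ 2 + (0 : ℝ) ^ 2) ≠ 0 :=
          mul_ne_zero hs' (by positivity)
        fun_prop (disch := exact this)
      have h7 := h6.tendsto
      simp only [zero_div, neg_zero] at h7
      exact h7.mono_left nhdsWithin_le_nhds
  set J : ℝ := Real.pi⁻¹ * ∫ s, (α - s)⁻¹ ∂lam with hJ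
  -- Im Q(α + iε) equals its limit J plus ε times a quantity that tends to 0. The critical value
  -- cancels J, leaving only the real first-order coefficient.
  have hdiff : ∀ ε : ℝ, 0 < ε → (lineCauchy lam ((α : ℂ) + (ε : ℂ) * Complex.I)).im
      = ε * (Real.pi⁻¹ * ∫ s, -(ε / ((α - s) * ((α - s) ^ 2 + ε ^ 2))) ∂lam) + J := by
    intro ε hε
    have hi : Integrable (fun s => (α - s) / ((α - s) ^ 2 + ε ^ 2)) lam := by
      have := (integrable_cauchyKernel lam (z := (α : ℂ) + (ε : ℂ) * Complex.I)
        (by rwa [verticalPoint_im])).im.const_mul Real.pi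
      refine this.congr (Eventually.of_forall fun s => ?_)
      simp only [RCLike.im_to_complex, cauchyKernel_im, verticalPoint_re, verticalPoint_im]
      rw [mul_inv_cancel_left₀ hpi.ne']
    have h1 : ∫ s, ε * -(ε / ((α - s) * ((α - s) ^ 2 + ε ^ 2))) ∂lam
        = ∫ s, ((α - s) / ((α - s) ^ 2 + ε ^ 2) - (α - s)⁻¹) ∂lam := by
      refine integral_congr_ae ?_
      filter_upwards [hne] with s hs
      have hs' : α - s ≠ 0 := sub_ne_zero.2 hs.symm
      have : (α - s) ^ 2 + ε ^ 2 ≠ 0 := by positivity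
      field_simp
      ring
    rw [integral_const_mul, integral_sub hi hji] at h1
    rw [lineCauchy_im lam (by rwa [verticalPoint_im]), verticalPoint_im, verticalPoint_re,
      mul_left_comm, h1, hJ]
    ring
  have hJlim : Tendsto (fun ε : ℝ => (lineCauchy lam ((α : ℂ) + (ε : ℂ) * Complex.I)).im)
      (𝓝[>] 0) (𝓝 J) := by
    have h2 := ((tendsto_id.mono_left (nhdsWithin_le_nhds (s := Set.Ioi (0 : ℝ)))).mul
      (him.const_mul Real.pi⁻¹)).add_const J
    rw [zero_mul, zero_add] at h2
    refine h2.congr' ?_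
    filter_upwards [self_mem_nhdsWithin] with ε hε
    exact (hdiff ε hε).symm
  have hJeq : J = Real.pi⁻¹ * (c₁ * α + c₀) := tendsto_nhds_unique hJlim hα
  have h3 := ((Complex.continuous_ofReal.tendsto _).comp ((hre.const_add c₁).const_mul
    Real.pi⁻¹)).add (((Complex.continuous_ofReal.tendsto _).comp
      (him.const_mul Real.pi⁻¹)).mul_const Complex.I)
  rw [mul_zero, Complex.ofReal_zero, zero_mul, add_zero] at h3
  refine h3.congr' ?_
  filter_upwards [self_mem_nhdsWithin] with ε hε
  have hε' : (0 : ℝ) < ε := hε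
  have hεc : (ε : ℂ) ≠ 0 := by exact_mod_cast hε'.ne'
  rw [eq_div_iff hεc, ← Complex.re_add_im (affineCauchy lam c₀ c₁ _), affineCauchy_re,
    affineCauchy_im, verticalPoint_re, verticalPoint_im, hdiff ε hε', hJeq,
    lineCauchy_re_vertical lam α hε']
  have h4 : ∫ s, ε / ((α - s) ^ 2 + ε ^ 2) ∂lam = ε * ∫ s, 1 / ((α - s) ^ 2 + ε ^ 2) ∂lam := by
    rw [← integral_const_mul]
    exact integral_congr_ae (Eventually.of_forall fun s => by ring)
  rw [h4]
  simp only [Function.comp_apply]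
  push_cast
  ring

/-- The atoms of the interconverted measure. -/
lemma measure_singleton_eq_atomWeight (hne : lam ≠ 0) (hc₁ : 0 ≤ c₁)
    (h : ∀ z : ℂ, 0 < z.im → affineCauchy lam c₀ c₁ z * affineCauchy μ ζ₀ ζ₁ z = 1)
    {α : ℝ} (hα : α ∈ atomSet lam c₀ c₁) : μ {α} = atomWeight lam c₁ α := by
  have hpi := Real.pi_pos
  have hμ := tendsto_mul_affineCauchy_re μ ζ₀ ζ₁ α
  have hinv : ∀ ε : ℝ, 0 < ε → affineCauchy μ ζ₀ ζ₁ ((α : ℂ) + (ε : ℂ) * Complex.I)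
      = (affineCauchy lam c₀ c₁ ((α : ℂ) + (ε : ℂ) * Complex.I))⁻¹ := fun ε hε =>
    eq_inv_of_mul_eq_one_right (h _ (by rwa [verticalPoint_im]))
  rw [← ENNReal.ofReal_toReal (measure_ne_top μ {α}), atomWeight]
  change ENNReal.ofReal (μ.real {α}) = _
  set A := ∫⁻ τ : ℝ, (ENNReal.ofReal ((τ - α) ^ 2))⁻¹ ∂lam with hA
  by_cases hAt : A = ⊤
  · have h1 : Tendsto (fun ε : ℝ => Real.pi * (ε *
        (affineCauchy μ ζ₀ ζ₁ ((α : ℂ) + (ε : ℂ) * Complex.I)).re)) (𝓝[>] 0) (𝓝 0) := by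
      have h2 := (tendsto_inv_atTop_zero.comp
        (tendsto_affineCauchy_re_div_atTop (c₀ := c₀) hc₁ hAt)).const_mul Real.pi
      rw [mul_zero] at h2
      refine squeeze_zero' ?_ ?_ h2
      all_goals
        filter_upwards [self_mem_nhdsWithin] with ε hε
        have hε' : (0 : ℝ) < ε := hε
        have h3 := affineCauchy_re_pos lam hne hc₁ (c₀ := c₀)
          (z := (α : ℂ) + (ε : ℂ) * Complex.I) (by rwa [verticalPoint_im])
        rw [hinv ε hε']
      · have := inv_re_nonneg h3.le
        positivity
      · rw [Function.comp_apply, inv_div, div_eq_mul_inv]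
        -- Re(1/F) ≤ 1/|F| ≤ 1/Re F, so ε Re G is at most the reciprocal of Re F/ε, which tends to
        -- infinity.
        have h4 : ((affineCauchy lam c₀ c₁ ((α : ℂ) + (ε : ℂ) * Complex.I))⁻¹).re
            ≤ (affineCauchy lam c₀ c₁ ((α : ℂ) + (ε : ℂ) * Complex.I)).re⁻¹ := by
          refine (Complex.re_le_norm _).trans ?_
          rw [norm_inv]
          have := Complex.re_le_norm (affineCauchy lam c₀ c₁ ((α : ℂ) + (ε : ℂ) * Complex.I))
          gcongr
        gcongr
    rw [tendsto_nhds_unique hμ h1, hAt]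
    simp
  · have hApos : 0 < A.toReal := ENNReal.toReal_pos (lintegral_inv_sq_pos hne α).ne' hAt
    have hsum : 0 < c₁ + A.toReal := by linarith
    have h1 := tendsto_affineCauchy_div (c₀ := c₀) (c₁ := c₁) hα.2 hAt
    have h2 := (h1.inv₀ (by
      rw [Complex.ofReal_ne_zero]
      positivity))
    have h3 := ((Complex.continuous_re.tendsto _).comp h2).const_mul Real.pi
    rw [← Complex.ofReal_inv, Complex.ofReal_re] at h3
    have h4 : μ.real {α} = Real.pi * (Real.pi⁻¹ * (c₁ + A.toReal))⁻¹ := by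
      refine tendsto_nhds_unique hμ (h3.congr' ?_)
      filter_upwards [self_mem_nhdsWithin] with ε hε
      rw [Function.comp_apply, hinv ε hε, inv_div, div_eq_mul_inv, Complex.re_ofReal_mul]
    have h5 : Real.pi * (Real.pi⁻¹ * (c₁ + A.toReal))⁻¹ = Real.pi ^ 2 * (c₁ + A.toReal)⁻¹ := by
      field_simp
    rw [h4, h5, ENNReal.ofReal_mul (by positivity), ENNReal.ofReal_inv_of_pos hsum,
      ENNReal.ofReal_add hc₁ hApos.le, ENNReal.ofReal_toReal hAt]

/-- The closed form of the interconverted measure. -/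
theorem eq_withDensity_add_sum_dirac (hne : lam ≠ 0) (hc₁ : 0 ≤ c₁) (hζ₁ : 0 ≤ ζ₁)
    (hZ : (atomSet lam c₀ c₁).Countable)
    (h : ∀ z : ℂ, 0 < z.im → affineCauchy lam c₀ c₁ z * affineCauchy μ ζ₀ ζ₁ z = 1) :
    μ = volume.withDensity (fun s => ENNReal.ofReal (interconvertedDensity lam c₀ c₁ s)) +
      Measure.sum (fun α : atomSet lam c₀ c₁ =>
        atomWeight lam c₁ (α : ℝ) • Measure.dirac (α : ℝ)) := by
  have hac : volume.withDensity (μ.rnDeriv volume)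
      = volume.withDensity (fun s => ENNReal.ofReal (interconvertedDensity lam c₀ c₁ s)) := by
    refine withDensity_congr_ae ?_
    filter_upwards [ae_acDensity_eq_interconvertedDensity h, μ.rnDeriv_lt_top volume] with x h1 h2
    rw [← h1, acDensity, ENNReal.ofReal_toReal h2.ne]
  have hdec := Measure.haveLebesgueDecomposition_add μ volume
  -- The absolutely continuous part has no point masses, so the atoms of μ are those of its singular
  -- part.
  have hatom : ∀ α : ℝ, μ.singularPart volume {α} = μ {α} := by
    intro α
    have h1 := congrArg (fun ν : Measure ℝ => ν {α}) hdec
    have h2 : volume.withDensity (μ.rnDeriv volume) {α} = 0 :=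
      withDensity_absolutelyContinuous _ _ (measure_singleton α)
    simp only [Measure.add_apply, h2, add_zero] at h1
    exact h1.symm
  have hsing : μ.singularPart volume = Measure.sum (fun α : atomSet lam c₀ c₁ =>
        atomWeight lam c₁ (α : ℝ) • Measure.dirac (α : ℝ)) := by
    have hcount : Countable (atomSet lam c₀ c₁) := hZ.to_subtype
    -- A measure carried by a countable set is the sum of its restrictions to points.
    have h1 := Measure.restrict_eq_self_of_ae_mem (ae_singularPart_mem_atomSet hc₁ hζ₁ h)
    rw [← Set.iUnion_of_singleton_coe (atomSet lam c₀ c₁), Measure.restrict_iUnion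
      (fun a b hab => by simpa using fun h0 => hab (Subtype.ext h0))
      (fun a => measurableSet_singleton _)] at h1
    rw [← h1]
    congr 1
    ext1 α
    rw [Measure.restrict_singleton, hatom, measure_singleton_eq_atomWeight hne hc₁ h α.2]
  rw [← hac, ← hsing, add_comm]
  exact hdec

lemma integrable_interconvertedDensity
    (h : ∀ z : ℂ, 0 < z.im → affineCauchy lam c₀ c₁ z * affineCauchy μ ζ₀ ζ₁ z = 1) :
    Integrable (interconvertedDensity lam c₀ c₁) :=
  (Measure.integrable_toReal_rnDeriv (μ := μ) (ν := volume)).congr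
    (ae_acDensity_eq_interconvertedDensity h)

end

/-! ### Discrete sets, integrability and the main theorem -/

lemma ContainsNoLimitPoint.mono {S T : Set ℝ} (hT : ContainsNoLimitPoint T) (h : S ⊆ T) :
    ContainsNoLimitPoint S :=
  fun s hs hacc => hT s (h hs) (hacc.mono (principal_mono.2 h))

/-- A set without limit points of its own is discrete as a subspace, and every subspace of the line
is Lindelöf. -/
lemma ContainsNoLimitPoint.countable {S : Set ℝ} (hS : ContainsNoLimitPoint S) : S.Countable := by
  have : DiscreteTopology S := discreteTopology_subtype_iff.2 fun x hx =>
    not_neBot.1 (hS x hx)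
  exact Set.countable_coe_iff.1 (countable_of_Lindelof_of_discrete (X := S))

lemma atomSet_subset_candidateSet (lam : Measure ℝ) (c₀ c₁ : ℝ) :
    atomSet lam c₀ c₁ ⊆ candidateSet lam c₀ c₁ := by
  intro s hs
  by_cases hsupp : s ∈ lam.support
  · exact Or.inl ⟨hs.1, hsupp⟩
  · exact Or.inr ⟨hs.2, hsupp⟩

lemma integrable_withDensity_of_mul {f g : ℝ → ℝ} (hf : Integrable f)
    (hf0 : ∀ᵐ s : ℝ, 0 ≤ f s) (h : Integrable (fun s => g s * f s)) :
    Integrable g (volume.withDensity fun s => ENNReal.ofReal (f s)) := by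
  rw [integrable_withDensity_iff_integrable_smul₀' hf.aemeasurable.ennreal_ofReal (by simp)]
  refine h.congr ?_
  filter_upwards [hf0] with s hs
  rw [ENNReal.toReal_ofReal hs, smul_eq_mul, mul_comm]

lemma Continuous.integrable_of_isCompact_support {μ : Measure ℝ} [IsFiniteMeasure μ]
    (hK : IsCompact μ.support) {g : ℝ → ℝ} (hg : Continuous g) : Integrable g μ := by
  obtain ⟨C, hC⟩ := hK.exists_bound_of_continuousOn hg.continuousOn
  refine Integrable.of_bound hg.aestronglyMeasurable C ?_
  filter_upwards [Measure.support_mem_ae (μ := μ)] with s hs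
  exact hC s hs

theorem mainTheorem1
    (f : ℝ → ℝ) (hf : MemLStar f)
    (lam₂ : Measure ℝ) (hfin : IsFiniteMeasure lam₂) (hcpt : IsCompact lam₂.support)
    (lam : Measure ℝ)
    (hlam : lam = volume.withDensity (fun s => ENNReal.ofReal (f s)) + lam₂)
    (hne : lam ≠ 0)
    (c₀ c₁ : ℝ) (hc₁ : 0 ≤ c₁)
    (hZ : ContainsNoLimitPoint (candidateSet lam c₀ c₁)) :
    MemWeighted (-1) lam ∧
    (∀ᵐ s : ℝ, HasLineHilbert lam s (lineHilbert lam s)) ∧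
    Integrable (interconvertedDensity lam c₀ c₁) ∧
    ContainsNoLimitPoint (atomSet lam c₀ c₁) ∧
    (∃! p : Measure ℝ × ℝ × ℝ, IsInterconversion lam c₀ c₁ p.1 p.2.1 p.2.2) ∧
    ∀ (μ : Measure ℝ) (ζ₀ ζ₁ : ℝ), IsInterconversion lam c₀ c₁ μ ζ₀ ζ₁ →
      μ = volume.withDensity (fun s => ENNReal.ofReal (interconvertedDensity lam c₀ c₁ s)) +
          Measure.sum (fun α : atomSet lam c₀ c₁ =>
            atomWeight lam c₁ (α : ℝ) • Measure.dirac (α : ℝ)) ∧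
      (c₁ ≠ 0 → ζ₀ = 0 ∧ ζ₁ = 0) ∧
      (c₁ = 0 → c₀ ≠ 0 → ζ₁ = 0 ∧ ζ₀ = -Real.pi ^ 2 / c₀) ∧
      (c₀ = 0 → c₁ = 0 →
        ζ₀ = -(Real.pi ^ 2 / (lam.real Set.univ) ^ 2) * ∫ τ : ℝ, τ ∂lam ∧
        ζ₁ = Real.pi ^ 2 / lam.real Set.univ) := by
  have hfin₁ : IsFiniteMeasure (volume.withDensity fun s => ENNReal.ofReal (f s)) :=
    isFiniteMeasure_withDensity_ofReal hf.integrable.2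
  have hfinite : IsFiniteMeasure lam := by rw [hlam]; infer_instance
  have hsq : Integrable (fun s : ℝ => s ^ 2) lam := by
    rw [hlam]
    exact (integrable_withDensity_of_mul hf.integrable hf.nonneg
      hf.integrable_sq).add_measure
      (Continuous.integrable_of_isCompact_support hcpt (by fun_prop))
  have hweight : Integrable (fun s : ℝ => (1 + s ^ 2) ^ (1 / 2 : ℝ)) lam := by
    rw [hlam]
    exact (integrable_withDensity_of_mul hf.integrable hf.nonneg
      hf.integrable_weight).add_measure
      (Continuous.integrable_of_isCompact_support hcpt
        (Continuous.rpow_const (by fun_prop) fun s => Or.inl (by positivity)))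
  have hatom := hZ.mono (atomSet_subset_candidateSet lam c₀ c₁)
  obtain ⟨ζ₀, ζ₁, C, hζ₁, h1, h2, h3, hpos, hC⟩ :=
    exists_affine_coefficients lam hne hsq c₀ hc₁
  obtain ⟨μ, hμ⟩ := exists_isInterconversion lam hne hc₁ hζ₁ hpos hC
  -- Every admissible triple is given by the same expressions, which yields uniqueness and the
  -- closed form together.
  have hformula : ∀ (ν : Measure ℝ) (ξ₀ ξ₁ : ℝ), IsInterconversion lam c₀ c₁ ν ξ₀ ξ₁ →
      ν = volume.withDensity (fun s => ENNReal.ofReal (interconvertedDensity lam c₀ c₁ s)) +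
          Measure.sum (fun α : atomSet lam c₀ c₁ =>
            atomWeight lam c₁ (α : ℝ) • Measure.dirac (α : ℝ)) ∧ ξ₀ = ζ₀ ∧ ξ₁ = ζ₁ := by
    intro ν ξ₀ ξ₁ hν
    obtain ⟨h4, h5, h6⟩ := hν.coefficients_eq hC
    exact ⟨eq_withDensity_add_sum_dirac hne hc₁ hν.nonneg_right hatom.countable hν.mul_eq_one,
      h4, h5⟩
  refine ⟨⟨inferInstance, by simpa using hweight⟩, ae_hasLineHilbert lam, ?_, hatom,
    ⟨(μ, ζ₀, ζ₁), hμ, ?_⟩, ?_⟩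
  · have hμfin := (hμ.coefficients_eq hC).2.2
    exact integrable_interconvertedDensity (μ := μ) hμ.mul_eq_one
  · rintro ⟨ν, ξ₀, ξ₁⟩ hν
    obtain ⟨h4, h5, h6⟩ := hformula ν ξ₀ ξ₁ hν
    simp only [Prod.mk.injEq]
    exact ⟨h4.trans (hformula μ ζ₀ ζ₁ hμ).1.symm, h5, h6⟩
  · intro ν ξ₀ ξ₁ hν
    obtain ⟨h4, rfl, rfl⟩ := hformula ν ξ₀ ξ₁ hν
    exact ⟨h4, h1, h2, h3⟩
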